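/- Proposition ("OPC bounds with bootstrapping"). Setup. Consider a discounted MDP with state space $\mathcal S$, action space $\mathcal A$, transition kernel $\mathbb P(\cdot\mid s,a)$, random rewards in $[0,1]$ with mean $r(s,a)$, discount factor $\gamma\in[0,1)$ and initial distribution $\nu$. Fix a stationary stochastic policy $\pi$ with discounted occupancy measure $d_\pi=(1-\gamma)\sum_{h\ge 0}\gamma^h\,\mathrm{Law}_\pi(S_h,A_h)$, and write $\mathbb E_\pi$ for the expectation under $d_\pi$. The Bellman error of $Q$ is $\mathcal B^\pi(Q)(s,a)=Q(s,a)-r(s,a)-\gamma\,\mathbb E_{s^+\sim\mathbb P(\cdot\mid s,a)}\mathbb E_{a^+\sim\pi(\cdot\mid s^+)}Q(s^+,a^+)$. Data. Let $\{(s_i,a_i,o_i,r_i,s_i^+)\}_{i=1}^n$ be an adapted dataset, where $o_i$ is an optional identifier and $\mathcal F_i$ is the $\sigma$-algebra generated by the samples with index $<i$. Conditionally on $\mathcal F_i$, the triple $(s_i,a_i,o_i)$ has a conditional distribution $\mu_i(\cdot\mid\mathcal F_i)$. Conditionally on $\mathcal F_i$ and $(s_i,a_i,o_i)$, the reward satisfies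 $|r_i|\le 1$ and has mean $r(s_i,a_i)$, and $s_i^+\sim\mathbb P(\cdot\mid s_i,a_i)$. The (possibly random) reference measure is $\mu=\frac1n\sum_{i=1}^n\mu_i(\cdot\mid\mathcal F_i)$. Linear setting. Let $\phi:\mathcal S\times\mathcal A\to\mathbb R^d$ be a measurable feature map with $\|\phi\|_2\le 1$, where $d\ge 1$ and $n\ge 2d$, and let $\mathcal Q=\{\langle w,\phi\rangle:\|w\|_2\le 1\}$. Let $\hat u_1,\dots,\hat u_d$ be an orthonormal basis of eigenvectors of the empirical covariance $\hat\Sigma=\frac1n\sum_{i=1}^n\phi(s_i,a_i)\phi(s_i,a_i)^\top$, and let $\hat{\mathcal F}=\{f_1,\dots,f_d\}$, $f_j=\langle\hat u_j,\phi\rangle$, be the resulting finite test class. For $\delta\in(0,1)$ and a constant $c_0>0$ let $$\rho=c_0\{d\log(n/d)+\log(n/\delta)\},\qquad\lambda=4\rho/n.$$ Define the population feasible set $$\mathcal C^\pi=\Big\{Q\in\mathcal Q:\ \frac{|\mathbb E_\mu[f\,\mathcal B^\pi(Q)]|}{\sqrt{\mathbb E_\mu[f^2]+\lambda}}\le\sqrt{\tfrac{4\rho}{n}}\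 \text{ for all } f\in\hat{\mathcal F}\Big\}$$ and the off-policy cost coefficient $$K^\pi=\sup_{Q\in\mathcal C^\pi}\frac{(\mathbb E_\pi[\mathcal B^\pi(Q)])^2}{(1+\lambda)\rho/n}.$$ Let $\phi^\pi_+(s,a)=\mathbb E_{s^+\sim\mathbb P(\cdot\mid s,a)}\mathbb E_{a^+\sim\pi(\cdot\mid s^+)}\phi(s^+,a^+)$, $\Sigma_\lambda=\mathbb E_\mu[\phi\phi^\top]+\lambda I$, $\Sigma^\pi_+=\mathbb E_\mu[\phi(\phi^\pi_+)^\top]$, and $$\Sigma^\pi_{\lambda,+}=\big(\Sigma_\lambda^{1/2}-\gamma\Sigma_\lambda^{-1/2}\Sigma^\pi_+\big)^\top\big(\Sigma_\lambda^{1/2}-\gamma\Sigma_\lambda^{-1/2}\Sigma^\pi_+\big).$$ Claim. For every $c_0>0$ there is a constant $c>0$, depending only on $c_0$, such that the following holds for all MDPs, policies, adapted datasets, dimensions $d$, sample sizes $n$, features and $\delta\in(0,1)$ as above. Assume weak realizability: almost surely there is $Q^\star\in\mathcal Q$ with $\mathbb E_\mu[f\,\mathcal B^\pi(Q^\star)]=0$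 for all $f\in\hat{\mathcal F}$ and $\mathbb E_\pi[\mathcal B^\pi(Q^\star)]=0$. Then, with probability at least $1-\delta$, $$K^\pi\ \le\ c\,d\,\big\|\mathbb E_\pi[\phi-\gamma\phi^\pi_+]\big\|^2_{(\Sigma^\pi_{\lambda,+})^{-1}}\qquad\text{where }\|v\|_{G^{-1}}^2=v^\top G^{-1}v,$$ whenever $\Sigma^\pi_{\lambda,+}$ is invertible. -/

import Mathlib

open MeasureTheory ProbabilityTheory
open scoped ENNReal MatrixOrder

noncomputable section

namespace OffPolicy

/-! ## Discounted Markov decision processes -/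

/-- An infinite-horizon discounted Markov decision process with a fixed initial distribution.
Rewards are random, with a law supported on `[0, 1]` for each state-action pair. -/
structure MDP (S A : Type*) [MeasurableSpace S] [MeasurableSpace A] where
  /-- transition kernel -/
  trans : Kernel (S × A) S
  isMarkov_trans : IsMarkovKernel trans
  /-- reward distribution -/
  rewardLaw : Kernel (S × A) ℝ
  isMarkov_rewardLaw : IsMarkovKernel rewardLaw
  rewardLaw_mem : ∀ x, ∀ᵐ y ∂(rewardLaw x), y ∈ Set.Icc (0 : ℝ) 1
  /-- discount factor -/
  γ : ℝ
  γ_nonneg : 0 ≤ γ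
  γ_lt_one : γ < 1
  /-- distribution of the starting state -/
  start : Measure S
  isProb_start : IsProbabilityMeasure start

attribute [instance] MDP.isMarkov_trans MDP.isMarkov_rewardLaw MDP.isProb_start

section General

variable {S A : Type*} [MeasurableSpace S] [MeasurableSpace A]

/-- Mean reward `r(s, a)`. -/
def MDP.meanReward (M : MDP S A) (x : S × A) : ℝ := ∫ y, y ∂(M.rewardLaw x)

/-- Marginal law of `(S_h, A_h)`, for `S_0 ∼ start`, `A_h ∼ π(· | S_h)` and
`S_{h+1} ∼ trans (S_h, A_h)`. -/
def MDP.stepLaw (M : MDP S A) (π : Kernel S A) : ℕ → Measure (S × A)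
  | 0 => M.start ⊗ₘ π
  | h + 1 => (M.trans ∘ₘ M.stepLaw π h) ⊗ₘ π

/-- Discounted occupancy measure `(1 - γ) ∑ₕ γ ^ h ℙ[(S_h, A_h) ∈ ·]`. -/
def MDP.occupancy (M : MDP S A) (π : Kernel S A) : Measure (S × A) :=
  Measure.sum fun h : ℕ => ENNReal.ofReal ((1 - M.γ) * M.γ ^ h) • M.stepLaw π h

/-- The expected next-step value of a (real or vector valued) function `g`: the conditional
expectation of `g(S⁺, A⁺)`, with `S⁺ ∼ trans x` and `A⁺ ∼ π(· | S⁺)`. -/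
def MDP.nextExp {E : Type*} [NormedAddCommGroup E] [NormedSpace ℝ E]
    (M : MDP S A) (π : Kernel S A) (g : S × A → E) (x : S × A) : E :=
  ∫ s, ∫ a, g (s, a) ∂(π s) ∂(M.trans x)

/-- Bellman error of `Q` for the policy `π`. -/
def MDP.bellmanError (M : MDP S A) (π : Kernel S A) (Q : S × A → ℝ) (x : S × A) : ℝ :=
  Q x - M.meanReward x - M.γ * M.nextExp π Q x

/-! ## Weak Bellman equations

Reference measures live on triples (state, action, identifier), encoded as `(S × A) × O`. -/

variable {O : Type*} [MeasurableSpace O]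

/-- `𝒬` is weakly realizable for `π` with respect to the test class `ℱ` and the measure `μ`. -/
def WeaklyRealizable (M : MDP S A) (π : Kernel S A) (𝒬 : Set (S × A → ℝ))
    (ℱ : Set ((S × A) × O → ℝ)) (μ : Measure ((S × A) × O)) : Prop :=
  ∃ Q ∈ 𝒬, (∀ f ∈ ℱ, ∫ z, f z * M.bellmanError π Q z.1 ∂μ = 0) ∧
    ∫ x, M.bellmanError π Q x ∂(M.occupancy π) = 0

/-- Population feasible set with radius `ρ`, regularization `lam` and sample size `n`. -/
def feasibleSet (M : MDP S A) (π : Kernel S A) (𝒬 : Set (S × A → ℝ))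
    (ℱ : Set ((S × A) × O → ℝ)) (μ : Measure ((S × A) × O)) (n : ℕ) (ρ lam : ℝ) :
    Set (S × A → ℝ) :=
  {Q | Q ∈ 𝒬 ∧ ∀ f ∈ ℱ,
    |∫ z, f z * M.bellmanError π Q z.1 ∂μ| / √((∫ z, f z ^ 2 ∂μ) + lam) ≤ √(4 * ρ / n)}

/-- Off-policy cost coefficient: the supremum over the population feasible set of
`(𝔼_π[Bellman error of Q])² / ((1 + lam) ρ / n)`. -/
def opc (M : MDP S A) (π : Kernel S A) (𝒬 : Set (S × A → ℝ))
    (ℱ : Set ((S × A) × O → ℝ)) (μ : Measure ((S × A) × O)) (n : ℕ) (ρ lam : ℝ) : ℝ≥0∞ :=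
  ⨆ Q ∈ feasibleSet M π 𝒬 ℱ μ n ρ lam,
    ENNReal.ofReal ((∫ x, M.bellmanError π Q x ∂(M.occupancy π)) ^ 2 / ((1 + lam) * (ρ / n)))

/-! ## Adapted datasets -/

/-- The σ-algebra generated by the samples (state-action pair, identifier, reward, next state)
with index strictly smaller than `i`. -/
@[reducible] def pastSigma {Ω : Type*} {n : ℕ} (pair : Fin n → Ω → S × A) (ident : Fin n → Ω → O)
    (reward : Fin n → Ω → ℝ) (next : Fin n → Ω → S) (i : Fin n) : MeasurableSpace Ω :=
  ⨆ j : Fin n, ⨆ _ : j < i,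
    MeasurableSpace.comap (fun ω => (pair j ω, ident j ω, reward j ω, next j ω)) inferInstance

/-- The σ-algebra of the past of sample `i` together with its own triple
(state, action, identifier). -/
@[reducible] def pastTripleSigma {Ω : Type*} {n : ℕ} (pair : Fin n → Ω → S × A)
    (ident : Fin n → Ω → O) (reward : Fin n → Ω → ℝ) (next : Fin n → Ω → S) (i : Fin n) :
    MeasurableSpace Ω :=
  pastSigma pair ident reward next i ⊔
    MeasurableSpace.comap (fun ω => (pair i ω, ident i ω)) inferInstance

/-- An adapted dataset of `n` samples (state-action pair, identifier, noisy reward, next state):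
given the past, each triple (state, action, identifier) has a conditional law; given the past and
the triple, the reward is unbiased and the next state follows the transition kernel. -/
structure AdaptedDataset (M : MDP S A) (O : Type*) [MeasurableSpace O]
    {Ω : Type*} [MeasurableSpace Ω] (P : Measure Ω) (n : ℕ) where
  pair : Fin n → Ω → S × A
  ident : Fin n → Ω → O
  reward : Fin n → Ω → ℝ
  next : Fin n → Ω → S
  measurable_pair : ∀ i, Measurable (pair i)
  measurable_ident : ∀ i, Measurable (ident i)
  measurable_reward : ∀ i, Measurable (reward i)
  measurable_next : ∀ i, Measurable (next i)
  /-- conditional law of the `i`-th triple given the past -/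
  condLaw : Fin n → Ω → Measure ((S × A) × O)
  isProb_condLaw : ∀ i ω, IsProbabilityMeasure (condLaw i ω)
  measurable_condLaw : ∀ i, Measurable[pastSigma pair ident reward next i] (condLaw i)
  condLaw_spec : ∀ i, ∀ B : Set ((S × A) × O), MeasurableSet B →
    P⟦(fun ω => (pair i ω, ident i ω)) ⁻¹' B | pastSigma pair ident reward next i⟧ =ᵐ[P]
      fun ω => (condLaw i ω).real B
  reward_bound : ∀ i, ∀ᵐ ω ∂P, |reward i ω| ≤ 1
  reward_spec : ∀ i, P[reward i | pastTripleSigma pair ident reward next i] =ᵐ[P]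
    fun ω => M.meanReward (pair i ω)
  next_spec : ∀ i, ∀ B : Set S, MeasurableSet B →
    P⟦next i ⁻¹' B | pastTripleSigma pair ident reward next i⟧ =ᵐ[P]
      fun ω => (M.trans (pair i ω)).real B

/-- The (possibly random) reference measure: the average of the conditional laws. -/
def AdaptedDataset.refMeasure {M : MDP S A} {Ω : Type*} [MeasurableSpace Ω] {P : Measure Ω}
    {n : ℕ} (D : AdaptedDataset M O P n) (ω : Ω) : Measure ((S × A) × O) :=
  (n : ℝ≥0∞)⁻¹ • ∑ i, D.condLaw i ω

/-! ## Linear setting -/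

variable {d : ℕ}

/-- The class of linear functions `x ↦ ⟪w, φ x⟫` with `‖w‖ ≤ 1`. -/
def linClass (φ : S × A → EuclideanSpace ℝ (Fin d)) : Set (S × A → ℝ) :=
  {Q | ∃ w : EuclideanSpace ℝ (Fin d), ‖w‖ ≤ 1 ∧ Q = fun x => inner ℝ w (φ x)}

/-- The test class `{f_1, …, f_d}`, `f_j (s, a, o) = ⟪u_j, φ(s, a)⟫`. -/
def testClass (O : Type*) (φ : S × A → EuclideanSpace ℝ (Fin d))
    (u : Fin d → EuclideanSpace ℝ (Fin d)) : Set ((S × A) × O → ℝ) :=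
  Set.range fun j => fun z => inner ℝ (u j) (φ z.1)

/-- Empirical covariance matrix of the features at the sampled state-action pairs. -/
def empCov {n : ℕ} (φ : S × A → EuclideanSpace ℝ (Fin d)) (x : Fin n → S × A) :
    Matrix (Fin d) (Fin d) ℝ :=
  (n : ℝ)⁻¹ • ∑ i, Matrix.vecMulVec (φ (x i)).ofLp (φ (x i)).ofLp

/-- Cross second moment `𝔼_μ[φ ψᵀ]`. -/
def crossCov (φ ψ : S × A → EuclideanSpace ℝ (Fin d)) (μ : Measure ((S × A) × O)) :
    Matrix (Fin d) (Fin d) ℝ :=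
  Matrix.of fun i j => ∫ z, φ z.1 i * ψ z.1 j ∂μ

/-- Regularized population covariance `Σ_lam = 𝔼_μ[φ φᵀ] + lam I`. -/
def regCov (φ : S × A → EuclideanSpace ℝ (Fin d)) (μ : Measure ((S × A) × O)) (lam : ℝ) :
    Matrix (Fin d) (Fin d) ℝ :=
  crossCov φ φ μ + lam • (1 : Matrix (Fin d) (Fin d) ℝ)

/-- The bootstrapped covariance matrix: `Bᵀ B` with
`B = Σ_lam^{1/2} - γ Σ_lam^{-1/2} 𝔼_μ[φ (φ⁺)ᵀ]`, where `φ⁺` is the next-state feature map. -/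
def bootCov (M : MDP S A) (π : Kernel S A) (φ : S × A → EuclideanSpace ℝ (Fin d))
    (μ : Measure ((S × A) × O)) (lam : ℝ) : Matrix (Fin d) (Fin d) ℝ :=
  let R := CFC.sqrt (regCov φ μ lam)
  let B := R - M.γ • (R⁻¹ * crossCov φ (M.nextExp π φ) μ)
  B.transpose * B

/-- `𝔼_π[φ - γ φ⁺]`. -/
def bootFeature (M : MDP S A) (π : Kernel S A) (φ : S × A → EuclideanSpace ℝ (Fin d)) :
    EuclideanSpace ℝ (Fin d) :=
  ∫ x, (φ x - M.γ • M.nextExp π φ x) ∂(M.occupancy π)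

/-- The squared norm `vᵀ G⁻¹ v`, for an invertible matrix `G`. -/
def invNormSq (G : Matrix (Fin d) (Fin d) ℝ) (v : EuclideanSpace ℝ (Fin d)) : ℝ :=
  v.ofLp ⬝ᵥ (G⁻¹).mulVec v.ofLp

/-- The radius `c₀ {d log(n / d) + log(n / δ)}`. -/
def radius (c₀ : ℝ) (d n : ℕ) (δ : ℝ) : ℝ :=
  c₀ * (d * Real.log (n / d) + Real.log (n / δ))

end General

end OffPolicy

end

/-! Let `Q` be feasible with parameter `w`, let `ws` be a realizing parameter and Δ = w - ws, so ‖Δ‖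
≤ 2. Bellman errors of linear functions are affine in the parameter, so 𝔼_π[B Q] = ⟨Δ, v⟩ with v =
𝔼_π[φ - γφ⁺], and testing against u_j gives ⟨u_j, g⟩ with g = (𝔼_μ[φφᵀ] - γΣ₊)Δ. With G = Σ_{λ,+},
Cauchy–Schwarz (`dotProduct_sq_le_mul_inv`) gives ⟨Δ, v⟩² ≤ (ΔᵀGΔ)(vᵀG⁻¹v). So it is enough that
ΔᵀGΔ is of order dλ, because λ = 4ρ/n matches the denominator of the coefficient.

Since G = (Σ_λ - γΣ₊)ᵀ Σ_λ⁻¹ (Σ_λ - γΣ₊), the energy ΔᵀGΔ is the squared Σ_λ⁻¹-norm of g + λΔ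
(`dotProduct_bootCov_mulVec`). The λΔ part costs at most a multiple of λ, as Σ_λ ≥ λI. Feasibility
says ⟨u_j, g⟩² ≤ λ u_jᵀΣ_λu_j; were the u_j eigenvectors of Σ_λ, summing over j would bound the g
part by dλ. They diagonalize the empirical covariance instead, which is enough once its
regularization is comparable to Σ_λ up to a factor a (`dotProduct_inv_mulVec_le`); the price is a².

Comparability (`AdaptedDataset.exists_event_moment_comparable`) is the only probabilistic input. For
a fixed direction, an exponential supermartingale compares empirical and population moments up to a
factor 2 and an additive error. A union bound over a net of the unit ball of radius d/n makes this
uniform, and λ absorbs the additive errors. Uniformity over directions makes the dependence of the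
u_j on the data harmless. -/

namespace OffPolicy

/-! ### Exponential supermartingale bounds for adapted data -/

section Concentration

/-- The conditional law is given only set by set. Comparing the image under `X` of the measure with
density `Z` with the mixture of the `κ ω` on each set `B` gives an equality of measures, hence the
identity for every `g`, with no integrability conditions. -/
theorem lintegral_mul_comp_eq_of_condLaw {Ω T : Type*} {m mΩ : MeasurableSpace Ω}
    [MeasurableSpace T] (hm : m ≤ mΩ) (P : Measure Ω) [IsProbabilityMeasure P]
    {X : Ω → T} (hX : Measurable X) {κ : Ω → Measure T} (hp : ∀ ω, IsProbabilityMeasure (κ ω))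
    (hκ : Measurable[m] κ)
    (hspec : ∀ B, MeasurableSet B → P⟦X ⁻¹' B | m⟧ =ᵐ[P] fun ω => (κ ω).real B)
    {Z : Ω → ℝ≥0∞} (hZ : Measurable[m] Z) {g : T → ℝ≥0∞} (hg : Measurable g) :
    ∫⁻ ω, Z ω * g (X ω) ∂P = ∫⁻ ω, Z ω * ∫⁻ t, g t ∂(κ ω) ∂P := by
  have hκ' : Measurable κ := hκ.mono hm le_rfl
  have hZ' : Measurable Z := hZ.mono hm le_rfl
  have key : ∀ B, MeasurableSet B →
      ∫⁻ ω in X ⁻¹' B, Z ω ∂P = ∫⁻ ω, κ ω B * Z ω ∂P := by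
    intro B hB
    have hκB : Measurable fun ω => κ ω B := (Measure.measurable_coe hB).comp hκ'
    -- The defining property of conditional expectation identifies the two measures on `m` only,
    -- hence the trims; the `m`-measurable `Z` does not see the difference.
    have h1 : (P.restrict (X ⁻¹' B)).trim hm = (P.withDensity fun ω => κ ω B).trim hm := by
      refine @Measure.ext _ m _ _ fun A hA => ?_
      rw [trim_measurableSet_eq hm hA, trim_measurableSet_eq hm hA,
        Measure.restrict_apply (hm A hA), withDensity_apply _ (hm A hA)]
      have hXB : MeasurableSet (X ⁻¹' B) := hX hB
      have hint : Integrable ((X ⁻¹' B).indicator fun _ => (1 : ℝ)) P :=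
        (integrable_const 1).indicator hXB
      have h2 := setIntegral_condExp hm hint hA
      rw [setIntegral_congr_ae (g := fun ω => (κ ω).real B) (hm A hA)
        ((hspec B hB).mono fun ω h _ => h), integral_indicator hXB] at h2
      simp only [integral_const, smul_eq_mul, mul_one] at h2
      have h3 : ∫⁻ ω in A, κ ω B ∂P = ENNReal.ofReal (∫ ω in A, (κ ω).real B ∂P) := by
        rw [ofReal_integral_eq_lintegral_ofReal]
        · refine lintegral_congr fun ω => ?_
          rw [ofReal_measureReal]
        · refine Integrable.of_bound (C := 1) hκB.ennreal_toReal.aestronglyMeasurable ?_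
          refine Filter.Eventually.of_forall fun ω => ?_
          rw [Real.norm_of_nonneg measureReal_nonneg]
          exact measureReal_le_one
        · exact Filter.Eventually.of_forall fun ω => measureReal_nonneg
      rw [h3, h2, ofReal_measureReal, Measure.restrict_apply_univ, Measure.restrict_apply hXB,
        Set.inter_comm]
    calc ∫⁻ ω in X ⁻¹' B, Z ω ∂P
        = ∫⁻ ω, Z ω ∂((P.restrict (X ⁻¹' B)).trim hm) := (lintegral_trim hm hZ).symm
      _ = ∫⁻ ω, Z ω ∂((P.withDensity fun ω => κ ω B).trim hm) := by rw [h1]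
      _ = ∫⁻ ω, Z ω ∂(P.withDensity fun ω => κ ω B) := lintegral_trim hm hZ
      _ = ∫⁻ ω, κ ω B * Z ω ∂P := lintegral_withDensity_eq_lintegral_mul _ hκB hZ'
  have hmeas : (P.withDensity Z).map X = (P.withDensity Z).bind κ := by
    refine Measure.ext fun B hB => ?_
    have hκB : Measurable fun ω => κ ω B := (Measure.measurable_coe hB).comp hκ'
    rw [Measure.map_apply hX hB, withDensity_apply _ (hX hB), key B hB,
      Measure.bind_apply hB hκ'.aemeasurable,
      lintegral_withDensity_eq_lintegral_mul _ hZ' hκB]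
    exact lintegral_congr fun ω => mul_comm _ _
  have h4 : ∫⁻ t, g t ∂((P.withDensity Z).map X) = ∫⁻ t, g t ∂((P.withDensity Z).bind κ) := by
    rw [hmeas]
  rw [lintegral_map hg hX, Measure.lintegral_bind hκ'.aemeasurable hg.aemeasurable,
    lintegral_withDensity_eq_lintegral_mul (g := fun ω => g (X ω)) _ hZ' (hg.comp hX),
    lintegral_withDensity_eq_lintegral_mul (g := fun ω => ∫⁻ t, g t ∂(κ ω)) _ hZ'
      ((Measure.measurable_lintegral hg).comp hκ')] at h4
  exact h4

/-- A product of factors, each of which is nonincreasing in conditional mean, has mean at most 1. -/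
theorem lintegral_prod_le_one {Ω : Type*} [MeasurableSpace Ω] (P : Measure Ω)
    [IsProbabilityMeasure P] {n : ℕ} (F : Fin n → MeasurableSpace Ω) (W : Fin n → Ω → ℝ≥0∞)
    (hW : ∀ j k, j < k → Measurable[F k] (W j))
    (hstep : ∀ k, ∀ Z : Ω → ℝ≥0∞, Measurable[F k] Z →
      ∫⁻ ω, Z ω * W k ω ∂P ≤ ∫⁻ ω, Z ω ∂P) :
    ∫⁻ ω, ∏ i, W i ω ∂P ≤ 1 := by
  have key : ∀ k : ℕ, k ≤ n →
      ∫⁻ ω, ∏ i ∈ Finset.univ.filter (fun i : Fin n => (i : ℕ) < k), W i ω ∂P ≤ 1 := by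
    intro k
    induction k with
    | zero => intro _; simp
    | succ k ih =>
      intro hk
      have hins : Finset.univ.filter (fun i : Fin n => (i : ℕ) < k + 1) =
          insert ⟨k, hk⟩ (Finset.univ.filter (fun i : Fin n => (i : ℕ) < k)) := by
        ext i
        simp only [Finset.mem_filter, Finset.mem_univ, true_and, Finset.mem_insert, Fin.ext_iff]
        omega
      rw [hins]
      simp_rw [Finset.prod_insert (show (⟨k, hk⟩ : Fin n) ∉
        Finset.univ.filter (fun i : Fin n => (i : ℕ) < k) by simp), mul_comm (W ⟨k, hk⟩ _)]
      refine (hstep ⟨k, hk⟩ _ ?_).trans (ih (by omega))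
      refine Finset.measurable_fun_prod _ fun i hi => hW _ _ ?_
      simpa [Fin.lt_def] using hi
  have h := key n le_rfl
  simpa using h

/-- By convexity the exponential lies below its chord over [0, 1], whose slope e - 1 is less than 2.
-/
theorem exp_le_one_add_two_mul {x : ℝ} (h0 : 0 ≤ x) (h1 : x ≤ 1) : Real.exp x ≤ 1 + 2 * x := by
  have h := convexOn_exp.2 (Set.mem_univ (0 : ℝ)) (Set.mem_univ (1 : ℝ)) (sub_nonneg.2 h1) h0
    (sub_add_cancel 1 x)
  simp only [smul_eq_mul, mul_zero, mul_one, zero_add, Real.exp_zero] at h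
  nlinarith [Real.exp_one_lt_d9]

/-- The chord over [-1, 0] has slope 1 - 1/e, which exceeds 1/2. -/
theorem exp_neg_le_one_sub_half {x : ℝ} (h0 : 0 ≤ x) (h1 : x ≤ 1) :
    Real.exp (-x) ≤ 1 - x / 2 := by
  have h := convexOn_exp.2 (Set.mem_univ (0 : ℝ)) (Set.mem_univ (-1 : ℝ)) (sub_nonneg.2 h1) h0
    (sub_add_cancel 1 x)
  simp only [smul_eq_mul, mul_zero, mul_neg, mul_one, zero_add, Real.exp_zero] at h
  nlinarith [Real.exp_neg_one_lt_d9]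

/-- For values in [0, 1] the mean alone controls the exponential moment, with no variance term. The
factor 2 is affordable because moments are compared only up to constants. -/
theorem lintegral_exp_le {T : Type*} [MeasurableSpace T] (κ : Measure T) [IsProbabilityMeasure κ]
    {h : T → ℝ} (hm : Measurable h) (h0 : ∀ t, 0 ≤ h t) (h1 : ∀ t, h t ≤ 1) :
    ∫⁻ t, ENNReal.ofReal (Real.exp (h t)) ∂κ ≤ ENNReal.ofReal (Real.exp (2 * ∫ t, h t ∂κ)) := by
  have hint : Integrable h κ := Integrable.of_bound (C := 1) hm.aestronglyMeasurable
    (Filter.Eventually.of_forall fun t => by rw [Real.norm_of_nonneg (h0 t)]; exact h1 t)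
  calc ∫⁻ t, ENNReal.ofReal (Real.exp (h t)) ∂κ
      ≤ ∫⁻ t, ENNReal.ofReal (1 + 2 * h t) ∂κ := lintegral_mono fun t =>
        ENNReal.ofReal_le_ofReal (exp_le_one_add_two_mul (h0 t) (h1 t))
    _ = ENNReal.ofReal (∫ t, (1 + 2 * h t) ∂κ) := by
        refine (ofReal_integral_eq_lintegral_ofReal ((integrable_const _).add (hint.const_mul 2))
          (Filter.Eventually.of_forall fun t => ?_)).symm
        have := h0 t
        simp only [Pi.zero_apply, Pi.add_apply]
        linarith
    _ ≤ _ := by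
        refine ENNReal.ofReal_le_ofReal ?_
        rw [integral_add (integrable_const _) (hint.const_mul 2), integral_const_mul]
        simp only [integral_const, probReal_univ, smul_eq_mul, mul_one]
        linarith [Real.add_one_le_exp (2 * ∫ t, h t ∂κ)]

theorem lintegral_exp_neg_le {T : Type*} [MeasurableSpace T] (κ : Measure T)
    [IsProbabilityMeasure κ] {h : T → ℝ} (hm : Measurable h) (h0 : ∀ t, 0 ≤ h t)
    (h1 : ∀ t, h t ≤ 1) :
    ∫⁻ t, ENNReal.ofReal (Real.exp (-h t)) ∂κ ≤
      ENNReal.ofReal (Real.exp (-(∫ t, h t ∂κ) / 2)) := by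
  have hint : Integrable h κ := Integrable.of_bound (C := 1) hm.aestronglyMeasurable
    (Filter.Eventually.of_forall fun t => by rw [Real.norm_of_nonneg (h0 t)]; exact h1 t)
  calc ∫⁻ t, ENNReal.ofReal (Real.exp (-h t)) ∂κ
      ≤ ∫⁻ t, ENNReal.ofReal (1 - h t / 2) ∂κ := lintegral_mono fun t =>
        ENNReal.ofReal_le_ofReal (exp_neg_le_one_sub_half (h0 t) (h1 t))
    _ = ENNReal.ofReal (∫ t, (1 - h t / 2) ∂κ) := by
        refine (ofReal_integral_eq_lintegral_ofReal ((integrable_const _).sub (hint.div_const 2))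
          (Filter.Eventually.of_forall fun t => ?_)).symm
        have := h1 t
        simp only [Pi.zero_apply, Pi.sub_apply]
        linarith
    _ ≤ _ := by
        refine ENNReal.ofReal_le_ofReal ?_
        rw [integral_sub (integrable_const _) (hint.div_const 2), integral_div]
        simp only [integral_const, probReal_univ, smul_eq_mul, mul_one]
        linarith [Real.add_one_le_exp (-(∫ t, h t ∂κ) / 2)]

theorem measure_sum_ge_le {Ω : Type*} [MeasurableSpace Ω] (P : Measure Ω)
    {n : ℕ} (Y : Fin n → Ω → ℝ) (hY : ∀ i, Measurable (Y i))
    (h : ∫⁻ ω, ∏ i, ENNReal.ofReal (Real.exp (Y i ω)) ∂P ≤ 1) (t : ℝ) :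
    P {ω | t ≤ ∑ i, Y i ω} ≤ ENNReal.ofReal (Real.exp (-t)) := by
  have hprod : ∀ ω, ∏ i, ENNReal.ofReal (Real.exp (Y i ω)) =
      ENNReal.ofReal (Real.exp (∑ i, Y i ω)) := fun ω => by
    rw [Real.exp_sum, ENNReal.ofReal_prod_of_nonneg fun i _ => (Real.exp_pos _).le]
  simp_rw [hprod] at h
  have hmeas : Measurable fun ω => ENNReal.ofReal (Real.exp (∑ i, Y i ω)) :=
    (Real.measurable_exp.comp (Finset.measurable_fun_sum _ fun i _ => hY i)).ennreal_ofReal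
  have h2 := (mul_meas_ge_le_lintegral (μ := P) hmeas (ENNReal.ofReal (Real.exp t))).trans h
  have hset : {ω | ENNReal.ofReal (Real.exp t) ≤ ENNReal.ofReal (Real.exp (∑ i, Y i ω))} =
      {ω | t ≤ ∑ i, Y i ω} := by
    ext ω
    simp only [Set.mem_ofPred_eq]
    rw [ENNReal.ofReal_le_ofReal_iff (Real.exp_pos _).le, Real.exp_le_exp]
  rw [hset] at h2
  rw [Real.exp_neg, ENNReal.ofReal_inv_of_pos (Real.exp_pos t), ← one_div]
  rwa [ENNReal.le_div_iff_mul_le (Or.inl (by simp [Real.exp_pos])) (Or.inl ENNReal.ofReal_ne_top),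
    mul_comm]

variable {S A O : Type*} [MeasurableSpace S] [MeasurableSpace A] [MeasurableSpace O]
  {Ω : Type*} [MeasurableSpace Ω] {P : Measure Ω} {M : MDP S A} {n : ℕ}

/-- The `i`-th sampled triple (state, action, identifier). -/
def AdaptedDataset.triple (D : AdaptedDataset M O P n) (i : Fin n) (ω : Ω) : (S × A) × O :=
  (D.pair i ω, D.ident i ω)

theorem AdaptedDataset.measurable_triple (D : AdaptedDataset M O P n) (i : Fin n) :
    Measurable (D.triple i) :=
  (D.measurable_pair i).prodMk (D.measurable_ident i)

/-- The σ-algebra of the past of sample `i`. -/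
@[reducible] def AdaptedDataset.past (D : AdaptedDataset M O P n) (i : Fin n) :
    MeasurableSpace Ω :=
  pastSigma D.pair D.ident D.reward D.next i

theorem AdaptedDataset.past_le (D : AdaptedDataset M O P n) (i : Fin n) :
    D.past i ≤ ‹MeasurableSpace Ω› := by
  refine iSup_le fun j => iSup_le fun _ => Measurable.comap_le ?_
  exact (D.measurable_pair j).prodMk ((D.measurable_ident j).prodMk
    ((D.measurable_reward j).prodMk (D.measurable_next j)))

theorem AdaptedDataset.past_mono (D : AdaptedDataset M O P n) {i j : Fin n} (hij : i ≤ j) :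
    D.past i ≤ D.past j :=
  iSup_le fun k => iSup_le fun hk => le_iSup₂_of_le k (hk.trans_le hij) le_rfl

theorem AdaptedDataset.measurable_triple_past (D : AdaptedDataset M O P n) {j k : Fin n}
    (hjk : j < k) : Measurable[D.past k] (D.triple j) := by
  have h : Measurable[D.past k]
      (fun ω => (D.pair j ω, D.ident j ω, D.reward j ω, D.next j ω)) := by
    refine Measurable.mono (comap_measurable _) ?_ le_rfl
    exact le_iSup₂_of_le (f := fun (j : Fin n) (_ : j < k) => MeasurableSpace.comap
      (fun ω => (D.pair j ω, D.ident j ω, D.reward j ω, D.next j ω)) inferInstance) j hjk le_rfl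
  exact (measurable_fst.comp h).prodMk (measurable_fst.comp (measurable_snd.comp h))

theorem AdaptedDataset.measurable_condMean (D : AdaptedDataset M O P n) (i : Fin n)
    {h : (S × A) × O → ℝ} (hm : Measurable h) (h0 : ∀ z, 0 ≤ h z) :
    Measurable[D.past i] fun ω => ∫ z, h z ∂(D.condLaw i ω) := by
  have h1 : Measurable fun μ : Measure ((S × A) × O) => ∫ z, h z ∂μ := by
    simp_rw [fun μ : Measure ((S × A) × O) => integral_eq_lintegral_of_nonneg_ae (μ := μ)
      (Filter.Eventually.of_forall h0) hm.aestronglyMeasurable]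
    exact (Measure.measurable_lintegral hm.ennreal_ofReal).ennreal_toReal
  exact h1.comp (D.measurable_condLaw i)

/-- Each factor exp(h(X_i) - 2𝔼_i h) has conditional mean at most one, so the product has mean at
most one and Markov's inequality applies; independence is not needed. -/
theorem AdaptedDataset.measure_upper_le [IsProbabilityMeasure P] (D : AdaptedDataset M O P n)
    {h : (S × A) × O → ℝ} (hm : Measurable h) (h0 : ∀ z, 0 ≤ h z) (h1 : ∀ z, h z ≤ 1) (t : ℝ) :
    P {ω | t ≤ ∑ i, (h (D.triple i ω) - 2 * ∫ z, h z ∂(D.condLaw i ω))} ≤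
      ENNReal.ofReal (Real.exp (-t)) := by
  have hmean := fun i => D.measurable_condMean i hm h0
  refine measure_sum_ge_le P (fun i ω => h (D.triple i ω) - 2 * ∫ z, h z ∂(D.condLaw i ω))
    (fun i => (hm.comp (D.measurable_triple i)).sub
    (((hmean i).mono (D.past_le i) le_rfl).const_mul 2)) ?_ t
  refine lintegral_prod_le_one P D.past _ (fun j k hjk => ?_) fun k Z hZ => ?_
  · refine (Real.measurable_exp.comp ?_).ennreal_ofReal
    exact (hm.comp (D.measurable_triple_past hjk)).sub
      (((hmean j).mono (D.past_mono hjk.le) le_rfl).const_mul 2)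
  · have hp := D.isProb_condLaw k
    -- The compensator depends only on the past, so it joins the multiplier `Z`.
    have h2 := lintegral_mul_comp_eq_of_condLaw (D.past_le k) P (D.measurable_triple k) hp
      (D.measurable_condLaw k) (D.condLaw_spec k)
      (Z := fun ω => Z ω * ENNReal.ofReal (Real.exp (-(2 * ∫ z, h z ∂(D.condLaw k ω)))))
      (hZ.mul (Real.measurable_exp.comp ((hmean k).const_mul 2).neg).ennreal_ofReal)
      (g := fun z => ENNReal.ofReal (Real.exp (h z))) (Real.measurable_exp.comp hm).ennreal_ofReal
    calc _ = _ := lintegral_congr fun ω => by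
            rw [sub_eq_neg_add, Real.exp_add, ENNReal.ofReal_mul (Real.exp_pos _).le, ← mul_assoc]
      _ = _ := h2
      _ ≤ _ := lintegral_mono fun ω => by
            rw [mul_assoc]
            refine mul_le_of_le_one_right' ?_
            refine (mul_le_mul_right (lintegral_exp_le (D.condLaw k ω) hm h0 h1) _).trans ?_
            rw [← ENNReal.ofReal_mul (Real.exp_pos _).le, ← Real.exp_add]
            simp

theorem AdaptedDataset.measure_lower_le [IsProbabilityMeasure P] (D : AdaptedDataset M O P n)
    {h : (S × A) × O → ℝ} (hm : Measurable h) (h0 : ∀ z, 0 ≤ h z) (h1 : ∀ z, h z ≤ 1) (t : ℝ) :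
    P {ω | t ≤ ∑ i, ((∫ z, h z ∂(D.condLaw i ω)) / 2 - h (D.triple i ω))} ≤
      ENNReal.ofReal (Real.exp (-t)) := by
  have hmean := fun i => D.measurable_condMean i hm h0
  refine measure_sum_ge_le P (fun i ω => (∫ z, h z ∂(D.condLaw i ω)) / 2 - h (D.triple i ω))
    (fun i => (((hmean i).mono (D.past_le i) le_rfl).div_const 2).sub
    (hm.comp (D.measurable_triple i))) ?_ t
  refine lintegral_prod_le_one P D.past _ (fun j k hjk => ?_) fun k Z hZ => ?_
  · refine (Real.measurable_exp.comp ?_).ennreal_ofReal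
    exact (((hmean j).mono (D.past_mono hjk.le) le_rfl).div_const 2).sub
      (hm.comp (D.measurable_triple_past hjk))
  · have hp := D.isProb_condLaw k
    have h2 := lintegral_mul_comp_eq_of_condLaw (D.past_le k) P (D.measurable_triple k) hp
      (D.measurable_condLaw k) (D.condLaw_spec k)
      (Z := fun ω => Z ω * ENNReal.ofReal (Real.exp ((∫ z, h z ∂(D.condLaw k ω)) / 2)))
      (hZ.mul (Real.measurable_exp.comp ((hmean k).div_const 2)).ennreal_ofReal)
      (g := fun z => ENNReal.ofReal (Real.exp (-h z)))
      (Real.measurable_exp.comp hm.neg).ennreal_ofReal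
    calc _ = _ := lintegral_congr fun ω => by
            rw [sub_eq_add_neg, Real.exp_add, ENNReal.ofReal_mul (Real.exp_pos _).le, ← mul_assoc]
      _ = _ := h2
      _ ≤ _ := lintegral_mono fun ω => by
            rw [mul_assoc]
            refine mul_le_of_le_one_right' ?_
            refine (mul_le_mul_right (lintegral_exp_neg_le (D.condLaw k ω) hm h0 h1) _).trans ?_
            rw [← ENNReal.ofReal_mul (Real.exp_pos _).le, ← Real.exp_add]
            simp [neg_div]

end Concentration

/-! ### Nets of the unit ball -/

section Net

variable {E : Type*} [NormedAddCommGroup E] [NormedSpace ℝ E] [FiniteDimensional ℝ E]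

/-- Volumetric bound for the size of an `ε`-separated subset of the unit ball. -/
theorem card_le_of_separated_unitBall {ε : ℝ} (hε : 0 < ε) (hε1 : ε ≤ 1) (s : Finset E)
    (hs : ∀ x ∈ s, ‖x‖ ≤ 1) (h : ∀ x ∈ s, ∀ y ∈ s, x ≠ y → ε ≤ ‖x - y‖) :
    (s.card : ℝ) ≤ (3 / ε) ^ Module.finrank ℝ E := by
  borelize E
  let μ : Measure E := Measure.addHaar
  have hd : Set.Pairwise (s : Set E) (Function.onFun Disjoint fun c => Metric.ball c (ε / 2)) := by
    intro c hc x hx hcx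
    apply Metric.ball_disjoint_ball
    rw [dist_eq_norm]
    linarith [h c hc x hx hcx]
  -- Here ε ≤ 1 gives 1 + ε/2 ≤ 3/2, the origin of the 3 in the bound.
  have hsub : (⋃ c ∈ s, Metric.ball c (ε / 2)) ⊆ Metric.ball (0 : E) (3 / 2) := by
    refine Set.iUnion₂_subset fun x hx => Metric.ball_subset_ball' ?_
    rw [dist_zero_right]
    linarith [hs x hx]
  have hI : (s.card : ℝ≥0∞) * ENNReal.ofReal ((ε / 2) ^ Module.finrank ℝ E) *
      μ (Metric.ball 0 1) ≤ ENNReal.ofReal ((3 / 2) ^ Module.finrank ℝ E) * μ (Metric.ball 0 1) :=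
    calc (s.card : ℝ≥0∞) * ENNReal.ofReal ((ε / 2) ^ Module.finrank ℝ E) * μ (Metric.ball 0 1)
        = μ (⋃ c ∈ s, Metric.ball c (ε / 2)) := by
          rw [measure_biUnion_finset hd fun c _ => measurableSet_ball]
          simp only [μ.addHaar_ball_of_pos _ (half_pos hε)]
          simp only [Finset.sum_const, nsmul_eq_mul, mul_assoc]
      _ ≤ μ (Metric.ball (0 : E) (3 / 2)) := measure_mono hsub
      _ = _ := by rw [μ.addHaar_ball_of_pos _ (by norm_num)]
  have hJ := (ENNReal.mul_le_mul_iff_left (Metric.measure_ball_pos μ _ zero_lt_one).ne'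
    measure_ball_lt_top.ne).1 hI
  have hK := ENNReal.toReal_le_of_le_ofReal (by positivity) hJ
  rw [ENNReal.toReal_mul, ENNReal.toReal_ofReal (by positivity), ENNReal.toReal_natCast] at hK
  have hpos : 0 < (ε / 2) ^ Module.finrank ℝ E := by positivity
  rw [← le_div_iff₀ hpos, ← div_pow] at hK
  rwa [show (3 : ℝ) / ε = 3 / 2 / (ε / 2) by field_simp]

/-- A separated set that is not a net can be enlarged by a point, and the volumetric bound prevents
this from continuing forever. -/
theorem exists_finset_net_unitBall {ε : ℝ} (hε : 0 < ε) (hε1 : ε ≤ 1) :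
    ∃ N : Finset E, (∀ x ∈ N, ‖x‖ ≤ 1) ∧ (N.card : ℝ) ≤ (3 / ε) ^ Module.finrank ℝ E ∧
      ∀ x : E, ‖x‖ ≤ 1 → ∃ y ∈ N, ‖x - y‖ ≤ ε := by
  classical
  by_contra! hcon
  have key : ∀ k : ℕ, ∃ s : Finset E, s.card = k ∧ (∀ x ∈ s, ‖x‖ ≤ 1) ∧
      ∀ x ∈ s, ∀ y ∈ s, x ≠ y → ε ≤ ‖x - y‖ := by
    intro k
    induction k with
    | zero => exact ⟨∅, by simp⟩
    | succ k ih =>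
      obtain ⟨s, hk, hs, hsep⟩ := ih
      obtain ⟨x, hx, hxs⟩ := hcon s hs (card_le_of_separated_unitBall hε hε1 s hs hsep)
      have hxn : x ∉ s := fun hmem => by
        have := hxs x hmem
        simp only [sub_self, norm_zero] at this
        linarith
      refine ⟨insert x s, by rw [Finset.card_insert_of_notMem hxn, hk], ?_, ?_⟩
      · intro y hy
        rcases Finset.mem_insert.1 hy with rfl | hy
        exacts [hx, hs y hy]
      · intro y hy z hz hyz
        rcases Finset.mem_insert.1 hy with rfl | hy' <;>
          rcases Finset.mem_insert.1 hz with rfl | hz'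
        · exact absurd rfl hyz
        · exact (hxs z hz').le
        · rw [norm_sub_rev]
          exact (hxs y hy').le
        · exact hsep y hy' z hz' hyz
  obtain ⟨k, hk⟩ := exists_nat_gt ((3 / ε) ^ Module.finrank ℝ E)
  obtain ⟨s, hsk, hs, hsep⟩ := key k
  have := card_le_of_separated_unitBall hε hε1 s hs hsep
  rw [hsk] at this
  linarith

end Net

/-! ### Comparing empirical and population second moments -/

section Covariance

/-- A difference of squares factors, and one factor is at most 2. This carries bounds from the net
to the whole ball. -/
theorem abs_inner_sq_sub_le {E : Type*} [NormedAddCommGroup E] [InnerProductSpace ℝ E]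
    {w v x : E} (hw : ‖w‖ ≤ 1) (hv : ‖v‖ ≤ 1) (hx : ‖x‖ ≤ 1) :
    |inner ℝ w x ^ 2 - inner ℝ v x ^ 2| ≤ 2 * ‖w - v‖ := by
  have h1 : inner ℝ w x ^ 2 - inner ℝ v x ^ 2 = inner ℝ (w - v) x * inner ℝ (w + v) x := by
    rw [inner_sub_left, inner_add_left]; ring
  have h2 : |inner ℝ (w - v) x| ≤ ‖w - v‖ := (abs_real_inner_le_norm _ _).trans
    (mul_le_of_le_one_right (norm_nonneg _) hx)
  have h3 : |inner ℝ (w + v) x| ≤ 2 := (abs_real_inner_le_norm _ _).trans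
    ((mul_le_of_le_one_right (norm_nonneg _) hx).trans ((norm_add_le _ _).trans (by linarith)))
  rw [h1, abs_mul, mul_comm 2]
  exact mul_le_mul h2 h3 (abs_nonneg _) (norm_nonneg _)

theorem inner_sq_le_one {E : Type*} [NormedAddCommGroup E] [InnerProductSpace ℝ E]
    {w x : E} (hw : ‖w‖ ≤ 1) (hx : ‖x‖ ≤ 1) : inner ℝ w x ^ 2 ≤ 1 := by
  have h : |inner ℝ w x| ≤ 1 := (abs_real_inner_le_norm _ _).trans
    (mul_le_one₀ hw (norm_nonneg _) hx)
  exact (sq_le_one_iff_abs_le_one _).2 h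

variable {S A O : Type*} [MeasurableSpace S] [MeasurableSpace A] [MeasurableSpace O]
  {Ω : Type*} [MeasurableSpace Ω] {P : Measure Ω} {M : MDP S A} {n d : ℕ}

theorem AdaptedDataset.isProbabilityMeasure_refMeasure (D : AdaptedDataset M O P n) (hn : n ≠ 0)
    (ω : Ω) : IsProbabilityMeasure (D.refMeasure ω) := by
  have hp := fun i => D.isProb_condLaw i ω
  constructor
  simp only [AdaptedDataset.refMeasure, Measure.smul_apply, Measure.coe_finsetSum,
    Finset.sum_apply, measure_univ, Finset.sum_const, Finset.card_univ, Fintype.card_fin,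
    smul_eq_mul, nsmul_eq_mul, mul_one]
  exact ENNReal.inv_mul_cancel (by simpa using hn) (ENNReal.natCast_ne_top n)

theorem AdaptedDataset.integral_refMeasure (D : AdaptedDataset M O P n) (ω : Ω)
    {f : (S × A) × O → ℝ} (hf : ∀ i, Integrable f (D.condLaw i ω)) :
    ∫ z, f z ∂(D.refMeasure ω) = (n : ℝ)⁻¹ * ∑ i, ∫ z, f z ∂(D.condLaw i ω) := by
  rw [AdaptedDataset.refMeasure, integral_smul_measure,
    integral_finsetSum_measure fun i _ => hf i]
  simp

/-- Empirical second moment of the features in direction `w`. -/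
noncomputable def AdaptedDataset.empMoment (D : AdaptedDataset M O P n)
    (φ : S × A → EuclideanSpace ℝ (Fin d)) (w : EuclideanSpace ℝ (Fin d)) (ω : Ω) : ℝ :=
  (n : ℝ)⁻¹ * ∑ i, inner ℝ w (φ (D.pair i ω)) ^ 2

/-- Population second moment of the features in direction `w`. -/
noncomputable def AdaptedDataset.popMoment (D : AdaptedDataset M O P n)
    (φ : S × A → EuclideanSpace ℝ (Fin d)) (w : EuclideanSpace ℝ (Fin d)) (ω : Ω) : ℝ :=
  ∫ z, inner ℝ w (φ z.1) ^ 2 ∂(D.refMeasure ω)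

variable {φ : S × A → EuclideanSpace ℝ (Fin d)}

theorem measurable_inner_feature_sq (hφ : Measurable φ) (w : EuclideanSpace ℝ (Fin d)) :
    Measurable fun z : (S × A) × O => inner ℝ w (φ z.1) ^ 2 :=
  ((measurable_const.inner (hφ.comp measurable_fst)).pow_const 2)

theorem integrable_inner_feature_sq (hφ : Measurable φ) (hφ1 : ∀ x, ‖φ x‖ ≤ 1)
    (w : EuclideanSpace ℝ (Fin d)) (μ : Measure ((S × A) × O)) [IsFiniteMeasure μ] :
    Integrable (fun z : (S × A) × O => inner ℝ w (φ z.1) ^ 2) μ := by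
  refine Integrable.of_bound (C := ‖w‖ ^ 2)
    (measurable_inner_feature_sq hφ w).aestronglyMeasurable ?_
  refine Filter.Eventually.of_forall fun z => ?_
  rw [Real.norm_of_nonneg (sq_nonneg _), ← sq_abs]
  gcongr
  exact (abs_real_inner_le_norm _ _).trans (mul_le_of_le_one_right (norm_nonneg _) (hφ1 _))

theorem AdaptedDataset.abs_empMoment_sub_le (D : AdaptedDataset M O P n) (hn : n ≠ 0)
    (hφ1 : ∀ x, ‖φ x‖ ≤ 1) {w v : EuclideanSpace ℝ (Fin d)} (hw : ‖w‖ ≤ 1) (hv : ‖v‖ ≤ 1)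
    (ω : Ω) : |D.empMoment φ w ω - D.empMoment φ v ω| ≤ 2 * ‖w - v‖ := by
  have hn' : (0 : ℝ) < n := by exact_mod_cast Nat.pos_of_ne_zero hn
  rw [empMoment, empMoment, ← mul_sub, ← Finset.sum_sub_distrib, abs_mul,
    abs_of_pos (inv_pos.2 hn'), inv_mul_le_iff₀ hn']
  refine (Finset.abs_sum_le_sum_abs _ _).trans ((Finset.sum_le_sum fun i _ =>
    abs_inner_sq_sub_le hw hv (hφ1 _)).trans ?_)
  simp

theorem AdaptedDataset.abs_popMoment_sub_le (D : AdaptedDataset M O P n) (hn : n ≠ 0)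
    (hφ : Measurable φ) (hφ1 : ∀ x, ‖φ x‖ ≤ 1) {w v : EuclideanSpace ℝ (Fin d)} (hw : ‖w‖ ≤ 1)
    (hv : ‖v‖ ≤ 1) (ω : Ω) : |D.popMoment φ w ω - D.popMoment φ v ω| ≤ 2 * ‖w - v‖ := by
  have := D.isProbabilityMeasure_refMeasure hn ω
  rw [popMoment, popMoment, ← integral_sub (integrable_inner_feature_sq hφ hφ1 _ _)
    (integrable_inner_feature_sq hφ hφ1 _ _)]
  have h := norm_integral_le_of_norm_le_const (μ := D.refMeasure ω) (C := 2 * ‖w - v‖)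
    (f := fun z : (S × A) × O => inner ℝ w (φ z.1) ^ 2 - inner ℝ v (φ z.1) ^ 2)
    (Filter.Eventually.of_forall fun z => abs_inner_sq_sub_le hw hv (hφ1 _))
  simpa using h

theorem AdaptedDataset.popMoment_eq (D : AdaptedDataset M O P n)
    (hφ : Measurable φ) (hφ1 : ∀ x, ‖φ x‖ ≤ 1) (w : EuclideanSpace ℝ (Fin d)) (ω : Ω) :
    D.popMoment φ w ω =
      (n : ℝ)⁻¹ * ∑ i, ∫ z, inner ℝ w (φ z.1) ^ 2 ∂(D.condLaw i ω) :=
  D.integral_refMeasure ω fun i => by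
    have := D.isProb_condLaw i ω
    exact integrable_inner_feature_sq hφ hφ1 w _

/-- Deviation bounds in finitely many directions. -/
theorem AdaptedDataset.exists_event_finset [IsProbabilityMeasure P] (D : AdaptedDataset M O P n)
    (hn : n ≠ 0) (hφ : Measurable φ) (hφ1 : ∀ x, ‖φ x‖ ≤ 1)
    (N : Finset (EuclideanSpace ℝ (Fin d))) (hN : ∀ w ∈ N, ‖w‖ ≤ 1) {δ t : ℝ}
    (ht : 2 * (N.card * Real.exp (-t)) ≤ δ) :
    ∃ G : Set Ω, MeasurableSet G ∧ ENNReal.ofReal (1 - δ) ≤ P G ∧ ∀ ω ∈ G, ∀ w ∈ N,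
      D.empMoment φ w ω ≤ 2 * D.popMoment φ w ω + t / n ∧
      D.popMoment φ w ω ≤ 2 * D.empMoment φ w ω + 2 * (t / n) := by
  have hn' : (0 : ℝ) < n := by exact_mod_cast Nat.pos_of_ne_zero hn
  let h : EuclideanSpace ℝ (Fin d) → (S × A) × O → ℝ := fun w z => inner ℝ w (φ z.1) ^ 2
  have hm : ∀ w, Measurable (h w) := measurable_inner_feature_sq hφ
  have h0 : ∀ w z, 0 ≤ h w z := fun w z => sq_nonneg _
  have hc : ∀ w i, Measurable fun ω => ∫ z, h w z ∂(D.condLaw i ω) := fun w i =>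
    (D.measurable_condMean i (hm w) (h0 w)).mono (D.past_le i) le_rfl
  have ht' : ∀ w i, Measurable fun ω => h w (D.triple i ω) := fun w i =>
    (hm w).comp (D.measurable_triple i)
  let B₁ : EuclideanSpace ℝ (Fin d) → Set Ω := fun w =>
    {ω | t ≤ ∑ i, (h w (D.triple i ω) - 2 * ∫ z, h w z ∂(D.condLaw i ω))}
  let B₂ : EuclideanSpace ℝ (Fin d) → Set Ω := fun w =>
    {ω | t ≤ ∑ i, ((∫ z, h w z ∂(D.condLaw i ω)) / 2 - h w (D.triple i ω))}
  have hB₁ : ∀ w, MeasurableSet (B₁ w) := fun w => measurableSet_le measurable_const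
    (Finset.measurable_fun_sum _ fun i _ => (ht' w i).sub ((hc w i).const_mul 2))
  have hB₂ : ∀ w, MeasurableSet (B₂ w) := fun w => measurableSet_le measurable_const
    (Finset.measurable_fun_sum _ fun i _ => ((hc w i).div_const 2).sub (ht' w i))
  have hBm : MeasurableSet (⋃ w ∈ N, (B₁ w ∪ B₂ w)) :=
    Finset.measurableSet_biUnion _ fun w _ => (hB₁ w).union (hB₂ w)
  -- Union bound, with two bad events per direction.
  have hδ : P (⋃ w ∈ N, (B₁ w ∪ B₂ w)) ≤ ENNReal.ofReal δ := by
    calc P (⋃ w ∈ N, (B₁ w ∪ B₂ w)) ≤ ∑ w ∈ N, P (B₁ w ∪ B₂ w) := measure_biUnion_finset_le _ _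
      _ ≤ ∑ w ∈ N, ENNReal.ofReal (2 * Real.exp (-t)) := by
          refine Finset.sum_le_sum fun w hw => (measure_union_le _ _).trans ?_
          have h1 : ∀ z, h w z ≤ 1 := fun z => inner_sq_le_one (hN w hw) (hφ1 _)
          rw [two_mul, ENNReal.ofReal_add (Real.exp_pos _).le (Real.exp_pos _).le]
          exact add_le_add (D.measure_upper_le (hm w) (h0 w) h1 t)
            (D.measure_lower_le (hm w) (h0 w) h1 t)
      _ = ENNReal.ofReal (2 * (N.card * Real.exp (-t))) := by
          rw [Finset.sum_const, nsmul_eq_mul, ← ENNReal.ofReal_natCast,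
            ← ENNReal.ofReal_mul (Nat.cast_nonneg _)]
          congr 1
          ring
      _ ≤ _ := ENNReal.ofReal_le_ofReal ht
  refine ⟨(⋃ w ∈ N, (B₁ w ∪ B₂ w))ᶜ, hBm.compl, ?_, fun ω hω w hw => ?_⟩
  · have hδ0 : 0 ≤ δ := le_trans (by positivity) ht
    rw [prob_compl_eq_one_sub hBm, ENNReal.ofReal_sub _ hδ0, ENNReal.ofReal_one]
    exact tsub_le_tsub_left hδ _
  · have hω' : ω ∉ B₁ w ∪ B₂ w := fun hmem => hω (Set.mem_biUnion hw hmem)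
    have h1 : ∑ i, (h w (D.triple i ω) - 2 * ∫ z, h w z ∂(D.condLaw i ω)) < t :=
      not_le.1 fun hle => hω' (Or.inl hle)
    have h2 : ∑ i, ((∫ z, h w z ∂(D.condLaw i ω)) / 2 - h w (D.triple i ω)) < t :=
      not_le.1 fun hle => hω' (Or.inr hle)
    rw [Finset.sum_sub_distrib, ← Finset.mul_sum] at h1
    rw [Finset.sum_sub_distrib, ← Finset.sum_div] at h2
    have he : D.empMoment φ w ω = (∑ i, h w (D.triple i ω)) / n := by
      rw [empMoment, div_eq_inv_mul]
      rfl
    rw [D.popMoment_eq hφ hφ1, he, inv_mul_eq_div]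
    constructor
    · rw [← mul_div_assoc, ← add_div]
      gcongr
      linarith
    · rw [← mul_div_assoc, ← mul_div_assoc, ← add_div]
      gcongr
      linarith

/-- Uniform deviation bounds over the unit ball. -/
theorem AdaptedDataset.exists_event_unitBall [IsProbabilityMeasure P] (D : AdaptedDataset M O P n)
    (hd : 1 ≤ d) (hnd : 2 * d ≤ n) {δ : ℝ} (hδ0 : 0 < δ) (hδ1 : δ < 1)
    (hφ : Measurable φ) (hφ1 : ∀ x, ‖φ x‖ ≤ 1) :
    ∃ G : Set Ω, MeasurableSet G ∧ ENNReal.ofReal (1 - δ) ≤ P G ∧ ∀ ω ∈ G,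
      ∀ w : EuclideanSpace ℝ (Fin d), ‖w‖ ≤ 1 →
        D.empMoment φ w ω ≤ 2 * D.popMoment φ w ω + 20 * (radius 1 d n δ / n) ∧
        D.popMoment φ w ω ≤ 2 * D.empMoment φ w ω + 20 * (radius 1 d n δ / n) := by
  have hn : n ≠ 0 := by omega
  have hn' : (0 : ℝ) < n := by exact_mod_cast Nat.pos_of_ne_zero hn
  have hd' : (0 : ℝ) < d := by exact_mod_cast hd
  have hd1 : (1 : ℝ) ≤ d := by exact_mod_cast hd
  have hnd' : 2 * (d : ℝ) ≤ n := by exact_mod_cast hnd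
  -- With net radius d/n the discretization error is of order d/n and the logarithm of the net size
  -- is d log(3n/d); both are of the order of the radius ρ, the former after division by n.
  have hε : (0 : ℝ) < d / n := by positivity
  have hε1 : (d : ℝ) / n ≤ 1 := by rw [div_le_one hn']; linarith
  obtain ⟨N, hN1, hNc, hNn⟩ :=
    exists_finset_net_unitBall (E := EuclideanSpace ℝ (Fin d)) hε hε1
  rw [finrank_euclideanSpace_fin] at hNc
  -- This makes twice the bound on the net size times exp(-t) equal to δ.
  set t : ℝ := d * Real.log (3 / (d / n)) + Real.log (2 / δ) with ht
  have hexp : Real.exp t = (3 / ((d : ℝ) / n)) ^ d * (2 / δ) := by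
    rw [ht, Real.exp_add, Real.exp_log (by positivity), Real.exp_nat_mul,
      Real.exp_log (by positivity)]
  have hcard : 2 * (N.card * Real.exp (-t)) ≤ δ := by
    rw [Real.exp_neg, hexp]
    calc 2 * ((N.card : ℝ) * ((3 / ((d : ℝ) / n)) ^ d * (2 / δ))⁻¹)
        ≤ 2 * ((3 / ((d : ℝ) / n)) ^ d * ((3 / ((d : ℝ) / n)) ^ d * (2 / δ))⁻¹) := by gcongr
      _ = δ := by
          have : (0 : ℝ) < (3 / ((d : ℝ) / n)) ^ d := by positivity
          field_simp
  -- From n ≥ 2d, log(n/d) ≥ log 2, which absorbs log 3 and, as 2 log 2 > 1, also the bare d.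
  have hlog2 : Real.log 2 ≤ Real.log (n / d) :=
    Real.log_le_log (by norm_num) (by rw [le_div_iff₀ hd']; linarith)
  have hlog3 : Real.log 3 ≤ 2 * Real.log 2 := by
    rw [← Real.log_rpow (by norm_num)]
    exact Real.log_le_log (by norm_num) (by norm_num)
  have hlogδ : Real.log (2 / δ) ≤ Real.log (n / δ) := by
    refine Real.log_le_log (by positivity) ?_
    gcongr
    linarith
  have hlogδ0 : 0 ≤ Real.log (2 / δ) := Real.log_nonneg (by rw [le_div_iff₀ hδ0]; linarith)
  have hL : radius 1 d n δ = d * Real.log (n / d) + Real.log (n / δ) := by rw [radius, one_mul]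
  have htL : t ≤ 3 * radius 1 d n δ := by
    have h1 : Real.log (3 / ((d : ℝ) / n)) = Real.log 3 + Real.log (n / d) := by
      rw [← Real.log_mul (by norm_num) (by positivity)]
      congr 1
      field_simp
    have h2 : (d : ℝ) * (Real.log 3 + Real.log (n / d)) ≤ d * (3 * Real.log (n / d)) := by
      gcongr
      linarith
    rw [ht, h1, hL]
    linarith
  have hdL : (d : ℝ) ≤ 2 * radius 1 d n δ := by
    have h2 : (d : ℝ) * 1 ≤ d * (2 * Real.log (n / d)) := by
      gcongr
      linarith [Real.log_two_gt_d9]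
    rw [hL]
    linarith
  have htL' : t / n ≤ 3 * (radius 1 d n δ / n) := by
    rw [← mul_div_assoc]
    gcongr
  have hdL' : (d : ℝ) / n ≤ 2 * (radius 1 d n δ / n) := by
    rw [← mul_div_assoc]
    gcongr
  obtain ⟨G, hG, hPG, hGw⟩ := D.exists_event_finset hn hφ hφ1 N hN1 hcard
  refine ⟨G, hG, hPG, fun ω hω w hw => ?_⟩
  obtain ⟨v, hv, hwv⟩ := hNn w hw
  obtain ⟨h1, h2⟩ := hGw ω hω v hv
  have h3 := abs_le.1 (D.abs_empMoment_sub_le hn hφ1 hw (hN1 v hv) ω)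
  have h4 := abs_le.1 (D.abs_popMoment_sub_le hn hφ hφ1 hw (hN1 v hv) ω)
  -- Moving from `w` to `v` and back costs 6d/n, and the deviation at most 2t/n: in units of
  -- radius/n this is at most 6·2 + 2·3 = 18 ≤ 20.
  constructor <;> linarith [h3.1, h3.2, h4.1, h4.2]

theorem AdaptedDataset.empMoment_smul (D : AdaptedDataset M O P n) (r : ℝ)
    (w : EuclideanSpace ℝ (Fin d)) (ω : Ω) :
    D.empMoment φ (r • w) ω = r ^ 2 * D.empMoment φ w ω := by
  simp only [empMoment, inner_smul_left, mul_pow, ← Finset.mul_sum]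
  simp only [conj_trivial]
  ring

theorem AdaptedDataset.popMoment_smul (D : AdaptedDataset M O P n) (r : ℝ)
    (w : EuclideanSpace ℝ (Fin d)) (ω : Ω) :
    D.popMoment φ (r • w) ω = r ^ 2 * D.popMoment φ w ω := by
  simp only [popMoment, inner_smul_left, mul_pow, integral_const_mul, conj_trivial]

theorem AdaptedDataset.empMoment_nonneg (D : AdaptedDataset M O P n)
    (w : EuclideanSpace ℝ (Fin d)) (ω : Ω) : 0 ≤ D.empMoment φ w ω :=
  mul_nonneg (inv_nonneg.2 (Nat.cast_nonneg _)) (Finset.sum_nonneg fun _ _ => sq_nonneg _)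

theorem AdaptedDataset.popMoment_nonneg (D : AdaptedDataset M O P n)
    (w : EuclideanSpace ℝ (Fin d)) (ω : Ω) : 0 ≤ D.popMoment φ w ω :=
  integral_nonneg fun _ => sq_nonneg _

theorem radius_pos {c₀ : ℝ} (hc₀ : 0 < c₀) (hd : 1 ≤ d) (hnd : 2 * d ≤ n) {δ : ℝ} (hδ0 : 0 < δ)
    (hδ1 : δ < 1) : 0 < radius c₀ d n δ := by
  have hd' : (1 : ℝ) ≤ d := by exact_mod_cast hd
  have hnd' : 2 * (d : ℝ) ≤ n := by exact_mod_cast hnd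
  have h1 : 0 ≤ Real.log (n / d) :=
    Real.log_nonneg (by rw [le_div_iff₀ (by linarith)]; linarith)
  have h2 : 0 < Real.log (n / δ) := Real.log_pos (by rw [lt_div_iff₀ hδ0]; linarith)
  rw [radius]
  positivity

/-- The regularized empirical and population second moments are comparable in all directions. -/
theorem AdaptedDataset.exists_event_moment_comparable [IsProbabilityMeasure P]
    (D : AdaptedDataset M O P n) {c₀ : ℝ} (hc₀ : 0 < c₀) (hd : 1 ≤ d) (hnd : 2 * d ≤ n)
    {δ : ℝ} (hδ0 : 0 < δ) (hδ1 : δ < 1) {lam : ℝ} (hlam : lam = 4 * radius c₀ d n δ / n)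
    (hφ : Measurable φ) (hφ1 : ∀ x, ‖φ x‖ ≤ 1) :
    ∃ G : Set Ω, MeasurableSet G ∧ ENNReal.ofReal (1 - δ) ≤ P G ∧ ∀ ω ∈ G,
      ∀ w : EuclideanSpace ℝ (Fin d),
        D.empMoment φ w ω + lam * ‖w‖ ^ 2 ≤
          (2 + 5 / c₀) * (D.popMoment φ w ω + lam * ‖w‖ ^ 2) ∧
        D.popMoment φ w ω + lam * ‖w‖ ^ 2 ≤
          (2 + 5 / c₀) * (D.empMoment φ w ω + lam * ‖w‖ ^ 2) := by
  obtain ⟨G, hG, hPG, hGw⟩ := D.exists_event_unitBall hd hnd hδ0 hδ1 hφ hφ1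
  refine ⟨G, hG, hPG, fun ω hω w => ?_⟩
  have hn' : (0 : ℝ) < n := by
    have : 0 < n := by omega
    exact_mod_cast this
  have hlam0 : 0 < lam := by
    rw [hlam]
    have := radius_pos hc₀ hd hnd hδ0 hδ1
    positivity
  -- The additive error is a fixed multiple of `lam`, which explains the constant 2 + 5/c₀.
  have hr : 20 * (radius 1 d n δ / n) = 5 / c₀ * lam := by
    rw [hlam, radius, radius]
    field_simp
    ring
  have key : ∀ v : EuclideanSpace ℝ (Fin d), ‖v‖ = 1 →
      D.empMoment φ v ω + lam ≤ (2 + 5 / c₀) * (D.popMoment φ v ω + lam) ∧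
      D.popMoment φ v ω + lam ≤ (2 + 5 / c₀) * (D.empMoment φ v ω + lam) := by
    intro v hv
    obtain ⟨h1, h2⟩ := hGw ω hω v hv.le
    rw [hr] at h1 h2
    have h3 : 0 ≤ 5 / c₀ * D.popMoment φ v ω :=
      mul_nonneg (by positivity) (D.popMoment_nonneg v ω)
    have h4 : 0 ≤ 5 / c₀ * D.empMoment φ v ω :=
      mul_nonneg (by positivity) (D.empMoment_nonneg v ω)
    constructor <;> nlinarith
  -- Both inequalities are homogeneous of degree two, so unit vectors suffice.
  rcases eq_or_ne w 0 with rfl | hw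
  · simp [empMoment, popMoment]
  · have hw' : 0 < ‖w‖ := norm_pos_iff.2 hw
    have hv : ‖(‖w‖⁻¹ • w)‖ = 1 := norm_smul_inv_norm hw
    obtain ⟨h1, h2⟩ := key _ hv
    have hwv : w = ‖w‖ • (‖w‖⁻¹ • w) := by rw [smul_smul, mul_inv_cancel₀ hw'.ne', one_smul]
    have he : D.empMoment φ w ω = ‖w‖ ^ 2 * D.empMoment φ (‖w‖⁻¹ • w) ω := by
      rw [← D.empMoment_smul, ← hwv]
    have hp : D.popMoment φ w ω = ‖w‖ ^ 2 * D.popMoment φ (‖w‖⁻¹ • w) ω := by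
      rw [← D.popMoment_smul, ← hwv]
    rw [he, hp]
    have hs : 0 ≤ ‖w‖ ^ 2 := sq_nonneg _
    constructor
    · linarith [mul_le_mul_of_nonneg_left h1 hs]
    · linarith [mul_le_mul_of_nonneg_left h2 hs]

end Covariance

/-! ### Quadratic forms and inverse norms -/

section LinearAlgebra

variable {d : ℕ}

theorem dotProduct_ofLp (x y : EuclideanSpace ℝ (Fin d)) : x.ofLp ⬝ᵥ y.ofLp = inner ℝ x y := by
  simp [PiLp.inner_apply, dotProduct, mul_comm]

/-- Cauchy–Schwarz for a positive semidefinite form. -/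
theorem dotProduct_mulVec_sq_le {G : Matrix (Fin d) (Fin d) ℝ} (hG : G.PosSemidef)
    (x y : Fin d → ℝ) :
    (x ⬝ᵥ G.mulVec y) ^ 2 ≤ (x ⬝ᵥ G.mulVec x) * (y ⬝ᵥ G.mulVec y) := by
  have hsymm : y ⬝ᵥ G.mulVec x = x ⬝ᵥ G.mulVec y := by
    have hT : G.transpose = G := hG.isHermitian
    rw [Matrix.dotProduct_mulVec, ← Matrix.mulVec_transpose, hT, dotProduct_comm]
  have h : ∀ t : ℝ, 0 ≤ (y ⬝ᵥ G.mulVec y) * (t * t) + (2 * (x ⬝ᵥ G.mulVec y)) * t +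
      x ⬝ᵥ G.mulVec x := by
    intro t
    have := hG.dotProduct_mulVec_nonneg (x + t • y)
    simp only [star_trivial, Matrix.mulVec_add, Matrix.mulVec_smul, add_dotProduct,
      dotProduct_add, smul_dotProduct, dotProduct_smul, smul_eq_mul, hsymm] at this
    linarith
  have := discrim_le_zero h
  rw [discrim] at this
  linarith

/-- Cauchy–Schwarz for `G`, applied to `x` and G⁻¹v. -/
theorem dotProduct_sq_le_mul_inv {G : Matrix (Fin d) (Fin d) ℝ} (hG : G.PosSemidef)
    (hu : IsUnit G) (x v : Fin d → ℝ) :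
    (x ⬝ᵥ v) ^ 2 ≤ (x ⬝ᵥ G.mulVec x) * (v ⬝ᵥ (G⁻¹).mulVec v) := by
  have hdet : IsUnit G.det := (Matrix.isUnit_iff_isUnit_det G).1 hu
  have hGv : G.mulVec ((G⁻¹).mulVec v) = v := by
    rw [Matrix.mulVec_mulVec, Matrix.mul_nonsing_inv _ hdet, Matrix.one_mulVec]
  have h := dotProduct_mulVec_sq_le hG x ((G⁻¹).mulVec v)
  rwa [hGv, dotProduct_comm ((G⁻¹).mulVec v)] at h

theorem sum_inner_mul_inner_ofLp (u : OrthonormalBasis (Fin d) ℝ (EuclideanSpace ℝ (Fin d)))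
    (x y : EuclideanSpace ℝ (Fin d)) :
    inner ℝ x y = ∑ j, inner ℝ (u j) x * inner ℝ (u j) y := by
  rw [← u.sum_inner_mul_inner x y]
  simp_rw [real_inner_comm x]

/-- Bound on the bootstrapped quadratic form from directional bounds along an orthonormal basis
in which a matrix comparable to `G` is diagonal. -/
theorem dotProduct_inv_mulVec_le {G : Matrix (Fin d) (Fin d) ℝ} (hG : G.PosDef)
    (u : OrthonormalBasis (Fin d) ℝ (EuclideanSpace ℝ (Fin d))) {σ : Fin d → ℝ} {lam a : ℝ}
    (hσ : ∀ j, 0 ≤ σ j) (hlam : 0 < lam) (ha : 0 ≤ a)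
    (hupper : ∀ y : EuclideanSpace ℝ (Fin d),
      ∑ j, (σ j + lam) * inner ℝ (u j) y ^ 2 ≤ a * (y.ofLp ⬝ᵥ G.mulVec y.ofLp))
    (hdiag : ∀ j, (u j).ofLp ⬝ᵥ G.mulVec (u j).ofLp ≤ a * (σ j + lam))
    (hcoer : ∀ y : EuclideanSpace ℝ (Fin d), lam * ‖y‖ ^ 2 ≤ y.ofLp ⬝ᵥ G.mulVec y.ofLp)
    {g Δ : EuclideanSpace ℝ (Fin d)} (hΔ : ‖Δ‖ ≤ 2)
    (hg : ∀ j, inner ℝ (u j) g ^ 2 ≤ lam * ((u j).ofLp ⬝ᵥ G.mulVec (u j).ofLp)) :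
    (g + lam • Δ).ofLp ⬝ᵥ (G⁻¹).mulVec (g + lam • Δ).ofLp ≤ lam * (2 * a ^ 2 * d + 8) := by
  have hdet : IsUnit G.det := (Matrix.isUnit_iff_isUnit_det G).1 hG.isUnit
  set z : EuclideanSpace ℝ (Fin d) := g + lam • Δ with hz
  -- Duality: with y = G⁻¹z the target is q = ⟨y, z⟩ = yᵀGy. Bounding the pairings of `y` with both
  -- parts of `z` gives q² ≤ Kq, and `G` never has to be inverted in the basis `u`.
  set y : EuclideanSpace ℝ (Fin d) := WithLp.toLp 2 ((G⁻¹).mulVec z.ofLp) with hy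
  have hGy : G.mulVec y.ofLp = z.ofLp := by
    rw [hy, Matrix.mulVec_mulVec, Matrix.mul_nonsing_inv _ hdet, Matrix.one_mulVec]
  set q : ℝ := inner ℝ y z with hq
  have hyq : y.ofLp ⬝ᵥ G.mulVec y.ofLp = q := by rw [hGy, dotProduct_ofLp]
  have hgoal : z.ofLp ⬝ᵥ (G⁻¹).mulVec z.ofLp = q := by
    rw [hq, ← dotProduct_ofLp, dotProduct_comm]
  have hsplit : q = inner ℝ y g + lam * inner ℝ y Δ := by
    rw [hq, hz, inner_add_right, inner_smul_right]
  have hσl : ∀ j, 0 < σ j + lam := fun j => by linarith [hσ j]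
  have hq0 : 0 ≤ q := by rw [← hyq]; exact (by positivity : 0 ≤ lam * ‖y‖ ^ 2).trans (hcoer y)
  -- Cauchy–Schwarz with weights σ_j + lam: `hupper` supplies one factor `a`, and `hdiag` with `hg`
  -- the other.
  have hyg : inner ℝ y g ^ 2 ≤ (a * q) * (lam * a * d) := by
    have hcs := Finset.sum_mul_sq_le_sq_mul_sq Finset.univ
      (fun j => √(σ j + lam) * inner ℝ (u j) y) (fun j => inner ℝ (u j) g / √(σ j + lam))
    have h1 : ∀ j, √(σ j + lam) * inner ℝ (u j) y * (inner ℝ (u j) g / √(σ j + lam)) =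
        inner ℝ (u j) y * inner ℝ (u j) g := fun j => by
      have := Real.sqrt_pos.2 (hσl j)
      field_simp
    simp only [h1, mul_pow, div_pow, Real.sq_sqrt (hσl _).le, ← sum_inner_mul_inner_ofLp] at hcs
    refine hcs.trans (mul_le_mul ((hupper y).trans_eq (by rw [hyq])) ?_ ?_ (mul_nonneg ha hq0))
    · calc ∑ j, inner ℝ (u j) g ^ 2 / (σ j + lam) ≤ ∑ _j : Fin d, lam * a := by
            refine Finset.sum_le_sum fun j _ => ?_
            rw [div_le_iff₀ (hσl j), mul_assoc]
            exact (hg j).trans (mul_le_mul_of_nonneg_left (hdiag j) hlam.le)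
        _ = lam * a * d := by simp [mul_comm]
    · exact Finset.sum_nonneg fun j _ => div_nonneg (sq_nonneg _) (hσl j).le
  have hyΔ : (lam * inner ℝ y Δ) ^ 2 ≤ q * (4 * lam) := by
    have h1 : inner ℝ y Δ ^ 2 ≤ ‖y‖ ^ 2 * 4 := by
      have h2 : |inner ℝ y Δ| ≤ ‖y‖ * 2 := (abs_real_inner_le_norm _ _).trans
        (mul_le_mul_of_nonneg_left hΔ (norm_nonneg _))
      rw [← sq_abs]
      calc |inner ℝ y Δ| ^ 2 ≤ (‖y‖ * 2) ^ 2 := by gcongr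
        _ = ‖y‖ ^ 2 * 4 := by ring
    have h3 := hcoer y
    rw [hyq] at h3
    calc (lam * inner ℝ y Δ) ^ 2 = lam ^ 2 * inner ℝ y Δ ^ 2 := by ring
      _ ≤ lam ^ 2 * (‖y‖ ^ 2 * 4) := by gcongr
      _ = (lam * ‖y‖ ^ 2) * (4 * lam) := by ring
      _ ≤ q * (4 * lam) := by gcongr
  rw [hgoal]
  have hqq : q ^ 2 ≤ q * (lam * (2 * a ^ 2 * d + 8)) := by
    have h1 : q ^ 2 ≤ 2 * inner ℝ y g ^ 2 + 2 * (lam * inner ℝ y Δ) ^ 2 := by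
      rw [hsplit]
      nlinarith [sq_nonneg (inner ℝ y g - lam * inner ℝ y Δ)]
    linarith
  rcases hq0.eq_or_lt with h0 | h0
  · rw [← h0]; positivity
  · rw [sq] at hqq
    exact le_of_mul_le_mul_left hqq h0

end LinearAlgebra

/-! ### Moment matrices and the bootstrapped covariance -/

section Moments

variable {S A O : Type*} [MeasurableSpace S] [MeasurableSpace A] [MeasurableSpace O]
  {d n : ℕ} {φ ψ : S × A → EuclideanSpace ℝ (Fin d)}

theorem integrable_inner_mul_inner (hφ : Measurable φ) (hψ : Measurable ψ) {K L : ℝ}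
    (hφK : ∀ x, ‖φ x‖ ≤ K) (hψL : ∀ x, ‖ψ x‖ ≤ L) (μ : Measure ((S × A) × O))
    [IsFiniteMeasure μ] (x y : EuclideanSpace ℝ (Fin d)) :
    Integrable (fun z : (S × A) × O => inner ℝ x (φ z.1) * inner ℝ y (ψ z.1)) μ := by
  refine Integrable.of_bound (C := (‖x‖ * K) * (‖y‖ * L))
    ((measurable_const.inner (hφ.comp measurable_fst)).mul
      (measurable_const.inner (hψ.comp measurable_fst))).aestronglyMeasurable ?_
  refine Filter.Eventually.of_forall fun z => ?_
  have h1 : |inner ℝ x (φ z.1)| ≤ ‖x‖ * K := (abs_real_inner_le_norm _ _).trans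
    (mul_le_mul_of_nonneg_left (hφK _) (norm_nonneg _))
  have h2 : |inner ℝ y (ψ z.1)| ≤ ‖y‖ * L := (abs_real_inner_le_norm _ _).trans
    (mul_le_mul_of_nonneg_left (hψL _) (norm_nonneg _))
  rw [Real.norm_eq_abs, abs_mul]
  exact mul_le_mul h1 h2 (abs_nonneg _) ((abs_nonneg _).trans h1)

theorem dotProduct_crossCov_mulVec (hφ : Measurable φ) (hψ : Measurable ψ) {K L : ℝ}
    (hφK : ∀ x, ‖φ x‖ ≤ K) (hψL : ∀ x, ‖ψ x‖ ≤ L) (μ : Measure ((S × A) × O))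
    [IsFiniteMeasure μ] (x y : EuclideanSpace ℝ (Fin d)) :
    x.ofLp ⬝ᵥ (crossCov φ ψ μ).mulVec y.ofLp =
      ∫ z, inner ℝ x (φ z.1) * inner ℝ y (ψ z.1) ∂μ := by
  have hint : ∀ i j, Integrable (fun z : (S × A) × O => φ z.1 i * ψ z.1 j) μ := fun i j => by
    have := integrable_inner_mul_inner hφ hψ hφK hψL μ (EuclideanSpace.single i 1)
      (EuclideanSpace.single j 1)
    simpa [EuclideanSpace.inner_single_left] using this
  have h : ∀ z : (S × A) × O, inner ℝ x (φ z.1) * inner ℝ y (ψ z.1) =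
      ∑ i, ∑ j, x i * (y j * (φ z.1 i * ψ z.1 j)) := fun z => by
    rw [← dotProduct_ofLp, ← dotProduct_ofLp, dotProduct, dotProduct, Finset.sum_mul_sum]
    exact Finset.sum_congr rfl fun i _ => Finset.sum_congr rfl fun j _ => by ring
  simp_rw [h]
  rw [integral_finsetSum _ fun i _ => integrable_finsetSum _ fun j _ =>
    ((hint i j).const_mul _).const_mul _]
  refine Finset.sum_congr rfl fun i _ => ?_
  rw [integral_finsetSum _ fun j _ => ((hint i j).const_mul _).const_mul _,
    Matrix.mulVec, dotProduct, Finset.mul_sum]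
  refine Finset.sum_congr rfl fun j _ => ?_
  rw [integral_const_mul, integral_const_mul, crossCov, Matrix.of_apply]
  ring

theorem dotProduct_empCov_mulVec {S A : Type*} {φ : S × A → EuclideanSpace ℝ (Fin d)}
    (x : Fin n → S × A) (v w : EuclideanSpace ℝ (Fin d)) :
    v.ofLp ⬝ᵥ (empCov φ x).mulVec w.ofLp =
      (n : ℝ)⁻¹ * ∑ i, inner ℝ v (φ (x i)) * inner ℝ w (φ (x i)) := by
  rw [empCov, Matrix.smul_mulVec, Matrix.sum_mulVec, dotProduct_smul, dotProduct_sum, smul_eq_mul]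
  congr 1
  refine Finset.sum_congr rfl fun i _ => ?_
  rw [Matrix.vecMulVec_mulVec, ← dotProduct_ofLp, ← dotProduct_ofLp]
  simp [dotProduct_comm w.ofLp, mul_comm]

theorem dotProduct_regCov_mulVec (hφ : Measurable φ) {K : ℝ} (hφK : ∀ x, ‖φ x‖ ≤ K)
    (μ : Measure ((S × A) × O)) [IsFiniteMeasure μ] (lam : ℝ) (y : EuclideanSpace ℝ (Fin d)) :
    y.ofLp ⬝ᵥ (regCov φ μ lam).mulVec y.ofLp =
      (∫ z, inner ℝ y (φ z.1) ^ 2 ∂μ) + lam * ‖y‖ ^ 2 := by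
  rw [regCov, Matrix.add_mulVec, dotProduct_add, dotProduct_crossCov_mulVec hφ hφ hφK hφK,
    Matrix.smul_mulVec, Matrix.one_mulVec, dotProduct_smul, dotProduct_ofLp,
    real_inner_self_eq_norm_sq, smul_eq_mul]
  simp_rw [sq]

theorem posDef_regCov (hφ : Measurable φ) {K : ℝ} (hφK : ∀ x, ‖φ x‖ ≤ K)
    (μ : Measure ((S × A) × O)) [IsFiniteMeasure μ] {lam : ℝ} (hlam : 0 < lam) :
    (regCov φ μ lam).PosDef := by
  refine Matrix.PosDef.of_dotProduct_mulVec_pos ?_ fun x hx => ?_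
  · ext i j
    simp only [regCov, crossCov, Matrix.conjTranspose_apply, Matrix.add_apply, Matrix.of_apply,
      Matrix.smul_apply, Matrix.one_apply, star_trivial, mul_comm (φ _ i), eq_comm (a := i)]
  · have h := dotProduct_regCov_mulVec hφ hφK μ lam (WithLp.toLp 2 x)
    rw [star_trivial, h]
    have hx' : 0 < ‖(WithLp.toLp 2 x : EuclideanSpace ℝ (Fin d))‖ := by
      rw [norm_pos_iff]
      simpa using hx
    have : 0 ≤ ∫ z : (S × A) × O, inner ℝ (WithLp.toLp 2 x) (φ z.1) ^ 2 ∂μ :=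
      integral_nonneg fun _ => sq_nonneg _
    positivity

/-- With R² = Σ_λ, the factor R⁻¹ comes out of B = R⁻¹(Σ_λ - γΣ₊); the symmetry of R leaves R⁻¹R⁻¹ =
Σ_λ⁻¹ in the middle. -/
theorem bootCov_eq (M : MDP S A) (π : Kernel S A) {μ : Measure ((S × A) × O)} {lam : ℝ}
    (hpd : (regCov φ μ lam).PosDef) :
    bootCov M π φ μ lam =
      (regCov φ μ lam - M.γ • crossCov φ (M.nextExp π φ) μ).transpose *
        ((regCov φ μ lam)⁻¹ * (regCov φ μ lam - M.γ • crossCov φ (M.nextExp π φ) μ)) := by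
  set G := regCov φ μ lam
  set C := crossCov φ (M.nextExp π φ) μ
  have hRR : CFC.sqrt G * CFC.sqrt G = G := CFC.sqrt_mul_sqrt_self G hpd.posSemidef.nonneg
  have hRT : (CFC.sqrt G).transpose = CFC.sqrt G :=
    (Matrix.nonneg_iff_posSemidef.1 (CFC.sqrt_nonneg G)).isHermitian
  have hRu : IsUnit (CFC.sqrt G).det := by
    have h : IsUnit (CFC.sqrt G * CFC.sqrt G).det := by
      rw [hRR]; exact (Matrix.isUnit_iff_isUnit_det G).1 hpd.isUnit
    rw [Matrix.det_mul] at h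
    exact isUnit_of_mul_isUnit_left h
  have hB : CFC.sqrt G - M.γ • ((CFC.sqrt G)⁻¹ * C) = (CFC.sqrt G)⁻¹ * (G - M.γ • C) := by
    rw [Matrix.mul_sub, Matrix.mul_smul]
    congr 1
    nth_rewrite 3 [← hRR]
    rw [← Matrix.mul_assoc, Matrix.nonsing_inv_mul _ hRu, Matrix.one_mul]
  have hinv : G⁻¹ = (CFC.sqrt G)⁻¹ * (CFC.sqrt G)⁻¹ := by
    nth_rewrite 1 [← hRR]
    rw [Matrix.mul_inv_rev]
  change (CFC.sqrt G - M.γ • ((CFC.sqrt G)⁻¹ * C)).transpose *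
    (CFC.sqrt G - M.γ • ((CFC.sqrt G)⁻¹ * C)) = _
  rw [hB, Matrix.transpose_mul, Matrix.transpose_nonsing_inv, hRT, hinv]
  simp only [Matrix.mul_assoc]

theorem posSemidef_bootCov (M : MDP S A) (π : Kernel S A) (μ : Measure ((S × A) × O)) (lam : ℝ) :
    (bootCov M π φ μ lam).PosSemidef :=
  Matrix.posSemidef_conjTranspose_mul_self _

theorem dotProduct_bootCov_mulVec (M : MDP S A) (π : Kernel S A) {μ : Measure ((S × A) × O)}
    {lam : ℝ} (hpd : (regCov φ μ lam).PosDef) {v z : Fin d → ℝ}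
    (hz : (regCov φ μ lam - M.γ • crossCov φ (M.nextExp π φ) μ).mulVec v = z) :
    v ⬝ᵥ (bootCov M π φ μ lam).mulVec v = z ⬝ᵥ ((regCov φ μ lam)⁻¹).mulVec z := by
  rw [bootCov_eq M π hpd, ← Matrix.mulVec_mulVec, ← Matrix.mulVec_mulVec, hz,
    Matrix.dotProduct_mulVec, Matrix.vecMul_transpose, hz]

end Moments

/-! ### Bellman errors of linear functions -/

section Bellman

variable {S A O : Type*} [MeasurableSpace S] [MeasurableSpace A] [MeasurableSpace O]
  {d : ℕ} {φ : S × A → EuclideanSpace ℝ (Fin d)}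

theorem measurable_nextExp (M : MDP S A) (π : Kernel S A) [IsMarkovKernel π]
    (hφ : Measurable φ) : Measurable (M.nextExp π φ) := by
  have h1 : StronglyMeasurable fun s => ∫ a, φ (s, a) ∂(π s) :=
    StronglyMeasurable.integral_kernel_prod_right' hφ.stronglyMeasurable
  exact (StronglyMeasurable.integral_kernel (κ := M.trans) h1).measurable

theorem norm_integral_feature_le (π : Kernel S A) [IsMarkovKernel π] (hφ1 : ∀ x, ‖φ x‖ ≤ 1)
    (s : S) : ‖∫ a, φ (s, a) ∂(π s)‖ ≤ 1 := by
  have h := norm_integral_le_of_norm_le_const (μ := π s) (C := 1) (f := fun a => φ (s, a))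
    (Filter.Eventually.of_forall fun a => hφ1 _)
  simpa using h

theorem norm_nextExp_le (M : MDP S A) (π : Kernel S A) [IsMarkovKernel π]
    (hφ1 : ∀ x, ‖φ x‖ ≤ 1) (x : S × A) : ‖M.nextExp π φ x‖ ≤ 1 := by
  have h := norm_integral_le_of_norm_le_const (μ := M.trans x) (C := 1)
    (f := fun s => ∫ a, φ (s, a) ∂(π s))
    (Filter.Eventually.of_forall fun s => norm_integral_feature_le π hφ1 s)
  simpa [MDP.nextExp] using h

theorem nextExp_inner (M : MDP S A) (π : Kernel S A) [IsMarkovKernel π]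
    (hφ : Measurable φ) (hφ1 : ∀ x, ‖φ x‖ ≤ 1) (w : EuclideanSpace ℝ (Fin d)) (x : S × A) :
    M.nextExp π (fun y => inner ℝ w (φ y)) x = inner ℝ w (M.nextExp π φ x) := by
  have h1 : ∀ s, Integrable (fun a => φ (s, a)) (π s) := fun s =>
    Integrable.of_bound (C := 1) (hφ.comp measurable_prodMk_left).aestronglyMeasurable
      (Filter.Eventually.of_forall fun a => hφ1 _)
  have h2 : Integrable (fun s => ∫ a, φ (s, a) ∂(π s)) (M.trans x) :=
    Integrable.of_bound (C := 1)
      (StronglyMeasurable.integral_kernel_prod_right' hφ.stronglyMeasurable).aestronglyMeasurable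
      (Filter.Eventually.of_forall fun s => norm_integral_feature_le π hφ1 s)
  simp only [MDP.nextExp, integral_inner (h1 _), integral_inner h2]

theorem measurable_meanReward (M : MDP S A) : Measurable M.meanReward :=
  (StronglyMeasurable.integral_kernel (κ := M.rewardLaw) stronglyMeasurable_id).measurable

theorem abs_meanReward_le (M : MDP S A) (x : S × A) : |M.meanReward x| ≤ 1 := by
  have h := norm_integral_le_of_norm_le_const (μ := M.rewardLaw x) (C := 1) (f := fun y => y)
    ((M.rewardLaw_mem x).mono fun y hy => by
      rw [Real.norm_of_nonneg hy.1]; exact hy.2)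
  simpa [MDP.meanReward] using h

theorem bellmanError_inner (M : MDP S A) (π : Kernel S A) [IsMarkovKernel π]
    (hφ : Measurable φ) (hφ1 : ∀ x, ‖φ x‖ ≤ 1) (w : EuclideanSpace ℝ (Fin d)) (x : S × A) :
    M.bellmanError π (fun y => inner ℝ w (φ y)) x =
      inner ℝ w (φ x - M.γ • M.nextExp π φ x) - M.meanReward x := by
  rw [MDP.bellmanError, nextExp_inner M π hφ hφ1, inner_sub_right, inner_smul_right]
  ring

theorem measurable_sub_nextExp (M : MDP S A) (π : Kernel S A) [IsMarkovKernel π]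
    (hφ : Measurable φ) : Measurable fun x => φ x - M.γ • M.nextExp π φ x :=
  hφ.sub ((measurable_nextExp M π hφ).const_smul M.γ)

theorem norm_sub_nextExp_le (M : MDP S A) (π : Kernel S A) [IsMarkovKernel π]
    (hφ1 : ∀ x, ‖φ x‖ ≤ 1) (x : S × A) : ‖φ x - M.γ • M.nextExp π φ x‖ ≤ 2 := by
  have h1 : ‖M.γ • M.nextExp π φ x‖ ≤ 1 := by
    rw [norm_smul, Real.norm_of_nonneg M.γ_nonneg]
    exact mul_le_one₀ M.γ_lt_one.le (norm_nonneg _) (norm_nextExp_le M π hφ1 x)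
  linarith [norm_sub_le (φ x) (M.γ • M.nextExp π φ x), hφ1 x]

theorem measurable_bellmanError_inner (M : MDP S A) (π : Kernel S A) [IsMarkovKernel π]
    (hφ : Measurable φ) (hφ1 : ∀ x, ‖φ x‖ ≤ 1) (w : EuclideanSpace ℝ (Fin d)) :
    Measurable (M.bellmanError π fun y => inner ℝ w (φ y)) := by
  rw [funext (bellmanError_inner M π hφ hφ1 w)]
  exact (measurable_const.inner (measurable_sub_nextExp M π hφ)).sub (measurable_meanReward M)

theorem abs_bellmanError_inner_le (M : MDP S A) (π : Kernel S A) [IsMarkovKernel π]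
    (hφ : Measurable φ) (hφ1 : ∀ x, ‖φ x‖ ≤ 1) (w : EuclideanSpace ℝ (Fin d)) (x : S × A) :
    |M.bellmanError π (fun y => inner ℝ w (φ y)) x| ≤ ‖w‖ * 2 + 1 := by
  rw [bellmanError_inner M π hφ hφ1 w]
  refine (abs_sub _ _).trans (add_le_add ?_ (abs_meanReward_le M x))
  exact (abs_real_inner_le_norm _ _).trans
    (mul_le_mul_of_nonneg_left (norm_sub_nextExp_le M π hφ1 x) (norm_nonneg _))

/-- The rewards cancel, leaving a linear expression in the difference of parameters. -/
theorem bellmanError_inner_sub (M : MDP S A) (π : Kernel S A) [IsMarkovKernel π]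
    (hφ : Measurable φ) (hφ1 : ∀ x, ‖φ x‖ ≤ 1) (w v : EuclideanSpace ℝ (Fin d)) (x : S × A) :
    M.bellmanError π (fun y => inner ℝ w (φ y)) x - M.bellmanError π (fun y => inner ℝ v (φ y)) x =
      inner ℝ (w - v) (φ x - M.γ • M.nextExp π φ x) := by
  rw [bellmanError_inner M π hφ hφ1, bellmanError_inner M π hφ hφ1, inner_sub_left]
  ring

theorem isProbabilityMeasure_stepLaw (M : MDP S A) (π : Kernel S A) [IsMarkovKernel π] (h : ℕ) :
    IsProbabilityMeasure (M.stepLaw π h) := by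
  induction h with
  | zero => rw [MDP.stepLaw]; infer_instance
  | succ h ih => rw [MDP.stepLaw]; infer_instance

theorem isFiniteMeasure_occupancy (M : MDP S A) (π : Kernel S A) [IsMarkovKernel π] :
    IsFiniteMeasure (M.occupancy π) := by
  have hp := isProbabilityMeasure_stepLaw M π
  have hs : Summable fun h : ℕ => (1 - M.γ) * M.γ ^ h :=
    (summable_geometric_of_lt_one M.γ_nonneg M.γ_lt_one).mul_left _
  constructor
  rw [MDP.occupancy, Measure.sum_apply _ MeasurableSet.univ]
  simp only [Measure.smul_apply, measure_univ, smul_eq_mul, mul_one]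
  rw [← ENNReal.ofReal_tsum_of_nonneg (fun h => mul_nonneg (sub_nonneg.2 M.γ_lt_one.le)
    (pow_nonneg M.γ_nonneg _)) hs]
  exact ENNReal.ofReal_lt_top

theorem integral_bellmanError_sub_occupancy (M : MDP S A) (π : Kernel S A) [IsMarkovKernel π]
    (hφ : Measurable φ) (hφ1 : ∀ x, ‖φ x‖ ≤ 1) (w v : EuclideanSpace ℝ (Fin d)) :
    ∫ x, M.bellmanError π (fun y => inner ℝ w (φ y)) x ∂(M.occupancy π) -
      ∫ x, M.bellmanError π (fun y => inner ℝ v (φ y)) x ∂(M.occupancy π) =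
      inner ℝ (w - v) (bootFeature M π φ) := by
  have := isFiniteMeasure_occupancy M π
  have hint : ∀ w : EuclideanSpace ℝ (Fin d),
      Integrable (M.bellmanError π fun y => inner ℝ w (φ y)) (M.occupancy π) := fun w =>
    Integrable.of_bound (C := ‖w‖ * 2 + 1)
      (measurable_bellmanError_inner M π hφ hφ1 w).aestronglyMeasurable
      (Filter.Eventually.of_forall fun x => abs_bellmanError_inner_le M π hφ hφ1 w x)
  have hint' : Integrable (fun x => φ x - M.γ • M.nextExp π φ x) (M.occupancy π) :=
    Integrable.of_bound (C := 2) (measurable_sub_nextExp M π hφ).aestronglyMeasurable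
      (Filter.Eventually.of_forall fun x => norm_sub_nextExp_le M π hφ1 x)
  rw [← integral_sub (hint w) (hint v)]
  simp_rw [bellmanError_inner_sub M π hφ hφ1]
  rw [integral_inner hint', bootFeature]

/-- The matrix here is not regularized, so passing to Σ_λ - γΣ₊ later adds the term λΔ. -/
theorem integral_mul_bellmanError_sub (M : MDP S A) (π : Kernel S A) [IsMarkovKernel π]
    (hφ : Measurable φ) (hφ1 : ∀ x, ‖φ x‖ ≤ 1) (μ : Measure ((S × A) × O)) [IsFiniteMeasure μ]
    (e w v : EuclideanSpace ℝ (Fin d)) :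
    ∫ z, inner ℝ e (φ z.1) * M.bellmanError π (fun y => inner ℝ w (φ y)) z.1 ∂μ -
      ∫ z, inner ℝ e (φ z.1) * M.bellmanError π (fun y => inner ℝ v (φ y)) z.1 ∂μ =
      e.ofLp ⬝ᵥ (crossCov φ φ μ - M.γ • crossCov φ (M.nextExp π φ) μ).mulVec (w - v).ofLp := by
  have hint : ∀ w : EuclideanSpace ℝ (Fin d), Integrable (fun z : (S × A) × O =>
      inner ℝ e (φ z.1) * M.bellmanError π (fun y => inner ℝ w (φ y)) z.1) μ := fun w => by
    refine Integrable.of_bound (C := ‖e‖ * (‖w‖ * 2 + 1))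
      ((measurable_const.inner (hφ.comp measurable_fst)).mul
        ((measurable_bellmanError_inner M π hφ hφ1 w).comp measurable_fst)).aestronglyMeasurable
      (Filter.Eventually.of_forall fun z => ?_)
    rw [Real.norm_eq_abs, abs_mul]
    exact mul_le_mul ((abs_real_inner_le_norm _ _).trans
      (mul_le_of_le_one_right (norm_nonneg _) (hφ1 _)))
      (abs_bellmanError_inner_le M π hφ hφ1 w _) (abs_nonneg _) (norm_nonneg _)
  have hψ := measurable_nextExp M π hφ
  have hψ1 := norm_nextExp_le M π hφ1
  rw [← integral_sub (hint w) (hint v), Matrix.sub_mulVec, Matrix.smul_mulVec, dotProduct_sub,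
    dotProduct_smul, dotProduct_crossCov_mulVec hφ hφ hφ1 hφ1,
    dotProduct_crossCov_mulVec hφ hψ hφ1 hψ1, smul_eq_mul, ← integral_const_mul,
    ← integral_sub (integrable_inner_mul_inner hφ hφ hφ1 hφ1 μ _ _)
      ((integrable_inner_mul_inner hφ hψ hφ1 hψ1 μ _ _).const_mul _)]
  refine integral_congr_ae (Filter.Eventually.of_forall fun z => ?_)
  simp only
  rw [← mul_sub, bellmanError_inner_sub M π hφ hφ1, inner_sub_right, inner_smul_right]
  ring

end Bellman

/-! ### The deterministic bound and the conclusion -/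

section Main

variable {S A O : Type*} [MeasurableSpace S] [MeasurableSpace A] [MeasurableSpace O]
  {Ω : Type*} [MeasurableSpace Ω] {P : Measure Ω} {M : MDP S A} {n d : ℕ}
  {φ : S × A → EuclideanSpace ℝ (Fin d)}

theorem AdaptedDataset.dotProduct_empCov_mulVec_self (D : AdaptedDataset M O P n)
    (w : EuclideanSpace ℝ (Fin d)) (ω : Ω) :
    w.ofLp ⬝ᵥ (empCov φ fun i => D.pair i ω).mulVec w.ofLp = D.empMoment φ w ω := by
  simp_rw [dotProduct_empCov_mulVec, empMoment, sq]

theorem AdaptedDataset.empMoment_eigenvector (D : AdaptedDataset M O P n)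
    {e : EuclideanSpace ℝ (Fin d)} (he : ‖e‖ = 1) {ω : Ω} {σ : ℝ}
    (h : (empCov φ fun i => D.pair i ω).mulVec e.ofLp = σ • e.ofLp) :
    σ = D.empMoment φ e ω := by
  rw [← D.dotProduct_empCov_mulVec_self, h, dotProduct_smul, dotProduct_ofLp,
    real_inner_self_eq_norm_sq, he]
  simp

/-- Here the choice of test directions matters: in an eigenbasis the empirical form has no cross
terms. -/
theorem AdaptedDataset.sum_empMoment_mul_inner_sq (D : AdaptedDataset M O P n) {ω : Ω}
    (u : OrthonormalBasis (Fin d) ℝ (EuclideanSpace ℝ (Fin d)))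
    (h : ∀ j, (empCov φ fun i => D.pair i ω).mulVec (u j).ofLp =
      D.empMoment φ (u j) ω • (u j).ofLp) (y : EuclideanSpace ℝ (Fin d)) :
    ∑ j, D.empMoment φ (u j) ω * inner ℝ (u j) y ^ 2 = D.empMoment φ y ω := by
  have hy : y.ofLp = ∑ j, inner ℝ (u j) y • (u j).ofLp := by
    conv_lhs => rw [← u.sum_repr' y]
    simp
  rw [← D.dotProduct_empCov_mulVec_self]
  nth_rewrite 2 [hy]
  rw [Matrix.mulVec_sum, dotProduct_sum]
  refine Finset.sum_congr rfl fun j _ => ?_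
  rw [Matrix.mulVec_smul, h j, dotProduct_smul, dotProduct_smul, dotProduct_ofLp,
    real_inner_comm, smul_eq_mul, smul_eq_mul]
  ring

/-- Deterministic core, for a fixed outcome: the randomness enters only through `hcomp` and `hreal`.
-/
theorem AdaptedDataset.opc_le (D : AdaptedDataset M O P n) (π : Kernel S A) [IsMarkovKernel π]
    (hd : 1 ≤ d) (hn : n ≠ 0) (hφ : Measurable φ) (hφ1 : ∀ x, ‖φ x‖ ≤ 1) {ρ lam a : ℝ}
    (hρ : 0 < ρ) (hlam : lam = 4 * ρ / n) (ha : 0 ≤ a) {ω : Ω}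
    (u : OrthonormalBasis (Fin d) ℝ (EuclideanSpace ℝ (Fin d)))
    (hu : ∀ j, ∃ σ : ℝ,
      (empCov φ fun i => D.pair i ω).mulVec (u j).ofLp = σ • (u j).ofLp)
    (hreal : WeaklyRealizable M π (linClass φ) (testClass O φ u) (D.refMeasure ω))
    (hcomp : ∀ w : EuclideanSpace ℝ (Fin d),
      D.empMoment φ w ω + lam * ‖w‖ ^ 2 ≤ a * (D.popMoment φ w ω + lam * ‖w‖ ^ 2) ∧
      D.popMoment φ w ω + lam * ‖w‖ ^ 2 ≤ a * (D.empMoment φ w ω + lam * ‖w‖ ^ 2))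
    (hunit : IsUnit (bootCov M π φ (D.refMeasure ω) lam)) :
    opc M π (linClass φ) (testClass O φ u) (D.refMeasure ω) n ρ lam ≤
      ENNReal.ofReal ((8 * a ^ 2 + 32) * d *
        invNormSq (bootCov M π φ (D.refMeasure ω) lam) (bootFeature M π φ)) := by
  have hn' : (0 : ℝ) < n := by exact_mod_cast Nat.pos_of_ne_zero hn
  have hd' : (1 : ℝ) ≤ d := by exact_mod_cast hd
  have hlam0 : 0 < lam := by rw [hlam]; positivity
  have hprob := D.isProbabilityMeasure_refMeasure hn ω
  set μ := D.refMeasure ω with hμ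
  have hpd : (regCov φ μ lam).PosDef := posDef_regCov hφ hφ1 μ hlam0
  have hreg : ∀ y : EuclideanSpace ℝ (Fin d), y.ofLp ⬝ᵥ (regCov φ μ lam).mulVec y.ofLp =
      D.popMoment φ y ω + lam * ‖y‖ ^ 2 := dotProduct_regCov_mulVec hφ hφ1 μ lam
  have hu1 : ∀ j, ‖u j‖ = 1 := u.orthonormal.1
  have hσ : ∀ j, (empCov φ fun i => D.pair i ω).mulVec (u j).ofLp =
      D.empMoment φ (u j) ω • (u j).ofLp := fun j => by
    obtain ⟨σ, h⟩ := hu j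
    rw [← D.empMoment_eigenvector (hu1 j) h, h]
  obtain ⟨Qs, ⟨ws, hws, rfl⟩, hreal1, hreal2⟩ := hreal
  refine iSup₂_le fun Q hQ => ENNReal.ofReal_le_ofReal ?_
  obtain ⟨⟨w, hw, rfl⟩, hfeas⟩ := hQ
  set G := bootCov M π φ μ lam
  set Δ : EuclideanSpace ℝ (Fin d) := w - ws with hΔ
  set C := crossCov φ φ μ - M.γ • crossCov φ (M.nextExp π φ) μ with hC
  set g : EuclideanSpace ℝ (Fin d) := WithLp.toLp 2 (C.mulVec Δ.ofLp) with hg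
  have hΔ2 : ‖Δ‖ ≤ 2 := (norm_sub_le _ _).trans (by linarith)
  have hπ : ∫ x, M.bellmanError π (fun y => inner ℝ w (φ y)) x ∂(M.occupancy π) =
      Δ.ofLp ⬝ᵥ (bootFeature M π φ).ofLp := by
    rw [dotProduct_ofLp, ← integral_bellmanError_sub_occupancy M π hφ hφ1, hreal2, sub_zero]
  have hgu : ∀ j, inner ℝ (u j) g ^ 2 ≤
      lam * ((u j).ofLp ⬝ᵥ (regCov φ μ lam).mulVec (u j).ofLp) := by
    intro j
    have h1 := hfeas _ ⟨j, rfl⟩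
    have h2 := integral_mul_bellmanError_sub M π hφ hφ1 μ (u j) w ws
    rw [hreal1 _ ⟨j, rfl⟩, sub_zero] at h2
    rw [h2] at h1
    have h3 : inner ℝ (u j) g = (u j).ofLp ⬝ᵥ C.mulVec Δ.ofLp := (dotProduct_ofLp _ _).symm
    rw [← hC, ← hΔ, ← h3] at h1
    have h4 : (∫ z : (S × A) × O, inner ℝ (u j) (φ z.1) ^ 2 ∂μ) + lam =
        D.popMoment φ (u j) ω + lam * ‖u j‖ ^ 2 := by rw [hu1, one_pow, mul_one]; rfl
    have h5 : 0 < D.popMoment φ (u j) ω + lam * ‖u j‖ ^ 2 := by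
      have := D.popMoment_nonneg (φ := φ) (u j) ω
      rw [hu1]
      linarith
    -- The feasibility threshold 4ρ/n is exactly `lam`.
    rw [h4, div_le_iff₀ (Real.sqrt_pos.2 h5), ← hlam, ← Real.sqrt_mul hlam0.le] at h1
    rw [hreg, ← sq_abs]
    exact (Real.le_sqrt (abs_nonneg _) (mul_pos hlam0 h5).le).1 h1
  have hz : (regCov φ μ lam - M.γ • crossCov φ (M.nextExp π φ) μ).mulVec Δ.ofLp =
      (g + lam • Δ).ofLp := by
    have : regCov φ μ lam - M.γ • crossCov φ (M.nextExp π φ) μ =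
        C + lam • (1 : Matrix (Fin d) (Fin d) ℝ) := by
      rw [regCov, hC]
      abel
    rw [this, Matrix.add_mulVec, Matrix.smul_mulVec, Matrix.one_mulVec]
    rfl
  have hform : Δ.ofLp ⬝ᵥ G.mulVec Δ.ofLp ≤ lam * (2 * a ^ 2 * d + 8) := by
    rw [dotProduct_bootCov_mulVec M π hpd hz]
    refine dotProduct_inv_mulVec_le hpd u (σ := fun j => D.empMoment φ (u j) ω)
      (fun j => D.empMoment_nonneg _ ω) hlam0 ha (fun y => ?_) (fun j => ?_) (fun y => ?_) hΔ2 hgu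
    · simp only [add_mul, Finset.sum_add_distrib, ← Finset.mul_sum]
      rw [D.sum_empMoment_mul_inner_sq u hσ, u.sum_sq_inner_right, hreg]
      exact (hcomp y).1
    · have h := (hcomp (u j)).2
      rw [hreg]
      simpa [hu1] using h
    · rw [hreg]
      linarith [D.popMoment_nonneg (φ := φ) y ω]
  have hGp : G.PosSemidef := posSemidef_bootCov M π μ lam
  have hv0 : 0 ≤ invNormSq G (bootFeature M π φ) := by
    have := hGp.inv.dotProduct_mulVec_nonneg (bootFeature M π φ).ofLp
    simpa [invNormSq] using this
  have hcs := dotProduct_sq_le_mul_inv hGp hunit Δ.ofLp (bootFeature M π φ).ofLp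
  have hden : 0 < (1 + lam) * (ρ / n) := by positivity
  rw [hπ, div_le_iff₀ hden]
  calc (Δ.ofLp ⬝ᵥ (bootFeature M π φ).ofLp) ^ 2
      ≤ (Δ.ofLp ⬝ᵥ G.mulVec Δ.ofLp) * invNormSq G (bootFeature M π φ) := hcs
    _ ≤ (lam * (2 * a ^ 2 * d + 8)) * invNormSq G (bootFeature M π φ) := by gcongr
    -- Here lam = 4ρ/n, and d ≥ 1 absorbs the additive 32.
    _ ≤ ((ρ / n) * ((8 * a ^ 2 + 32) * d)) * invNormSq G (bootFeature M π φ) := by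
        refine mul_le_mul_of_nonneg_right ?_ hv0
        rw [hlam, show 4 * ρ / n * (2 * a ^ 2 * d + 8) = ρ / n * (8 * a ^ 2 * d + 32) by ring]
        gcongr
        linarith
    _ ≤ ((1 + lam) * (ρ / n) * ((8 * a ^ 2 + 32) * d)) * invNormSq G (bootFeature M π φ) := by
        gcongr
        exact le_mul_of_one_le_left (by positivity) (by linarith)
    _ = _ := by ring

end Main

end OffPolicy

theorem mainTheorem7 (c₀ : ℝ) (hc₀ : 0 < c₀) :
    ∃ c : ℝ, 0 < c ∧
      ∀ {S A O Ω : Type*} [MeasurableSpace S] [MeasurableSpace A] [MeasurableSpace O]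
        [MeasurableSpace Ω] (P : Measure Ω) [IsProbabilityMeasure P]
        (M : OffPolicy.MDP S A) (π : Kernel S A) [IsMarkovKernel π]
        (d n : ℕ) (_ : 1 ≤ d) (_ : 2 * d ≤ n) (δ : ℝ) (_ : 0 < δ) (_ : δ < 1)
        (φ : S × A → EuclideanSpace ℝ (Fin d)) (_ : Measurable φ) (_ : ∀ x, ‖φ x‖ ≤ 1)
        (D : OffPolicy.AdaptedDataset M O P n)
        (ρ lam : ℝ) (_ : ρ = OffPolicy.radius c₀ d n δ) (_ : lam = 4 * ρ / n)
        (u : Ω → OrthonormalBasis (Fin d) ℝ (EuclideanSpace ℝ (Fin d)))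
        (_ : ∀ ω j, ∃ σ : ℝ,
          (OffPolicy.empCov φ fun i => D.pair i ω).mulVec (u ω j).ofLp = σ • (u ω j).ofLp)
        (_ : ∀ᵐ ω ∂P, OffPolicy.WeaklyRealizable M π (OffPolicy.linClass φ)
          (OffPolicy.testClass O φ (u ω)) (D.refMeasure ω)),
        ∃ G : Set Ω, MeasurableSet G ∧ ENNReal.ofReal (1 - δ) ≤ P G ∧ ∀ ω ∈ G,
          IsUnit (OffPolicy.bootCov M π φ (D.refMeasure ω) lam) →
            OffPolicy.opc M π (OffPolicy.linClass φ) (OffPolicy.testClass O φ (u ω))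
                (D.refMeasure ω) n ρ lam ≤
              ENNReal.ofReal (c * d * OffPolicy.invNormSq
                (OffPolicy.bootCov M π φ (D.refMeasure ω) lam)
                (OffPolicy.bootFeature M π φ)) := by
  refine ⟨8 * (2 + 5 / c₀) ^ 2 + 32, by positivity, ?_⟩
  intro S A O Ω _ _ _ _ P _ M π _ d n hd hnd δ hδ0 hδ1 φ hφ hφ1 D ρ lam hρ hlam u hu hreal
  subst hρ
  obtain ⟨G, hG, hPG, hGw⟩ :=
    D.exists_event_moment_comparable hc₀ hd hnd hδ0 hδ1 hlam hφ hφ1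
  -- The failure set of realizability need not be measurable, so a measurable null superset is
  -- removed.
  obtain ⟨T, hT, hTm, hT0⟩ := exists_measurable_superset_of_null (ae_iff.1 hreal)
  refine ⟨G \ T, hG.diff hTm, by rwa [measure_sdiff_null hT0], fun ω hω hunit => ?_⟩
  have hreal' : OffPolicy.WeaklyRealizable M π (OffPolicy.linClass φ)
      (OffPolicy.testClass O φ (u ω)) (D.refMeasure ω) := by
    by_contra h
    exact hω.2 (hT h)
  exact D.opc_le π hd (by omega) hφ hφ1 (OffPolicy.radius_pos hc₀ hd hnd hδ0 hδ1) hlam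
    (by positivity) (u ω) (hu ω) hreal' (hGw ω hω.1) hunit
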